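/- Consider the 1-forms $\theta_0,\dots,\theta_3$, $\xi^1,\xi^2,\xi^3$, $\sigma_{11},\sigma_{12},\sigma_{13},\sigma_{22},\sigma_{23}$, $\eta_1,\dots,\eta_8$ (20 forms) and the additional 1-forms $\eta_9,\dots,\eta_{13}$, subject to the structure equations of the symmetry pseudo-group of the potential Khokhlov–Zabolotskaya equation $u_{yy}=u_{tx}+u_xu_{xx}$: $$\begin{aligned} d\theta_0&=\eta_1\wedge\theta_0+\xi^1\wedge\theta_1+\xi^2\wedge\theta_2+\xi^3\wedge\theta_3,\\ d\theta_1&=(\eta_1-\eta_2)\wedge\theta_1-2\eta_3\wedge\theta_3-\theta_0\wedge(\xi^2+\sigma_{22})+\xi^1\wedge\sigma_{11}+\xi^2\wedge\sigma_{12}+\xi^3\wedge\sigma_{13},\\ d\theta_2&=\tfrac12(\eta_1-\eta_2)\wedge\theta_2+\xi^1\wedge\sigma_{12}+\xi^2\wedge\sigma_{22}+\xi^3\wedge\sigma_{23},\\ d\theta_3&=\tfrac34(\eta_1-\eta_2)\wedge\theta_3-\eta_3\wedge\theta_2+\xi^1\wedge\sigma_{13}+\xi^2\wedge\sigma_{23}+\xi^3\wedge\sigma_{12},\\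 d\xi^1&=\eta_2\wedge\xi^1,\\ d\xi^2&=\tfrac12(\eta_1+\eta_2)\wedge\xi^2+\eta_3\wedge\xi^3-\theta_2\wedge\xi^1,\\ d\xi^3&=\tfrac14(\eta_1+3\eta_2)\wedge\xi^3+2\eta_3\wedge\xi^1,\\ d\sigma_{11}&=(\eta_1-2\eta_2)\wedge\sigma_{11}-4\eta_3\wedge\sigma_{13}-(\eta_4-\theta_2)\wedge\theta_0+\eta_6\wedge\xi^2+\eta_7\wedge\xi^3+\eta_8\wedge\xi^1\\&\quad-5\theta_1\wedge(\xi^2+\sigma_{22})+\theta_2\wedge\sigma_{12}-2\theta_3\wedge\sigma_{23},\\ d\sigma_{12}&=\tfrac12(\eta_1-3\eta_2)\wedge\sigma_{12}-2\eta_3\wedge\sigma_{23}+\eta_4\wedge\xi^2+\eta_5\wedge\xi^3+\eta_6\wedge\xi^1-\theta_2\wedge(2\xi^2+\sigma_{22}),\\ d\sigma_{13}&=\tfrac14(3\eta_1-7\eta_2)\wedge\sigma_{13}-3\eta_3\wedge\sigma_{12}+\eta_5\wedge\xi^2+\eta_6\wedge\xi^3+\eta_7\wedge\xi^1-3\theta_3\wedge(\xi^2+\sigma_{22}),\\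 d\sigma_{22}&=\eta_4\wedge\xi^1-\tfrac12\eta_1\wedge\xi^2-\tfrac12\eta_2\wedge(3\xi^2+2\sigma_{22})-\eta_3\wedge\xi^3,\\ d\sigma_{23}&=\tfrac14(\eta_1-5\eta_2)\wedge\sigma_{23}-\eta_3\wedge(\xi^2+\sigma_{22})+(\eta_4-\theta_2)\wedge\xi^3+\eta_5\wedge\xi^1,\\ d\eta_1&=\xi^1\wedge(\xi^2+\sigma_{22}),\\ d\eta_2&=-3\xi^1\wedge(\xi^2+\sigma_{22}),\\ d\eta_3&=\tfrac14(\eta_1-\eta_2)\wedge\eta_3+\sigma_{23}\wedge\xi^1-\xi^3\wedge(\xi^2+\sigma_{22}),\\ d\eta_4&=\eta_9\wedge\xi^1+\tfrac12\bigl(\eta_2\wedge(3\theta_2-4\eta_4)+\eta_1\wedge\theta_2\bigr)+\xi^2\wedge\sigma_{22}+\xi^3\wedge\sigma_{23},\\ d\eta_5&=\eta_9\wedge\xi^3+\eta_{10}\wedge\xi^1+\tfrac14(\eta_1-9\eta_2)\wedge\eta_5-3\eta_3\wedge(\eta_4-\theta_2)+\sigma_{12}\wedge\xi^3+3\sigma_{23}\wedge(\xi^2+\sigma_{22}),\\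 d\eta_6&=\eta_9\wedge\xi^2+\eta_{10}\wedge\xi^3+\eta_{11}\wedge\xi^1+\tfrac12(\eta_1-5\eta_2)\wedge\eta_6-4\eta_3\wedge\eta_5+\sigma_{12}\wedge(7\xi^2+6\sigma_{22}),\\ d\eta_7&=\eta_{10}\wedge\xi^2+\eta_{11}\wedge\xi^3+\eta_{12}\wedge\xi^1+\tfrac14(3\eta_1-11\eta_2)\wedge\eta_7-5\eta_3\wedge\eta_6+3\eta_4\wedge\theta_3\\&\quad-(\eta_5-3\theta_3)\wedge\theta_2+3\sigma_{12}\wedge\sigma_{23}+9\sigma_{13}\wedge(\xi^2+\sigma_{22}),\\ d\eta_8&=(\eta_1-3\eta_2)\wedge\eta_8+6(\eta_4\wedge\theta_1-\eta_3\wedge\eta_7+\sigma_{13}\wedge\sigma_{23})+2\eta_5\wedge\theta_3-2(\eta_6-3\theta_1)\wedge\theta_2\\&\quad-(\eta_9+\sigma_{12})\wedge\theta_0+\eta_{11}\wedge\xi^2+\eta_{12}\wedge\xi^3+\eta_{13}\wedge\xi^1+12\sigma_{11}\wedge(\xi^2+\sigma_{22}). \end{aligned}$$ Let $\mathfrak g_1$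 be the infinite-dimensional real Lie algebra defined by the infinite normal prolongation of these equations: repeatedly, structure equations are adjoined for the new forms of the previous step, with as many further new forms as there are free parameters, that is, independent ways to change the previous new forms by linear combinations of the 20 forms without changing their structure equations. Thus $\mathfrak g_1$ is spanned by the vectors dual to the forms of the prolonged system, with bracket determined by $d\theta(X,Y)=-\theta([X,Y])$. Each step adds five new forms, those of the first being $\eta_9,\dots,\eta_{13}$. (In a closed form: $\mathfrak g_1$ is a Lie algebra of tuples $(a;f,g,h,k,l)$ with $a\in\mathbb R$ and $f,g,h,k,l\in\mathbb R[t]$, the forms above being explicit linear combinations of $a$ and of the derivatives of $f,\dots,l$ at $t=0$.) Let $C^k(\mathfrak g_1)$ be the space of all skew-symmetric $k$-linear maps $\mathfrak g_1^k\to\mathbb R$ with the usual Lie algebra differential $d$ (trivial coefficients), and let $H^1(\mathfrak g_1)$ be the first cohomology, i.e. the space of closed 1-forms. For a closed 1-form $\zeta$ and $\lambda\in\mathbb R$ let $d_{\lambda\zeta}\Theta=d\Theta+\lambda\,\zeta\wedge\Theta$ and $$H^2_{\lambda\zeta}(\mathfrak g_1)=\ker(d_{\lambda\zeta}\colon C^2\to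 C^3)\big/\operatorname{im}(d_{\lambda\zeta}\colon C^1\to C^2).$$ Let $I$ be the exterior ideal generated by the 20 forms $\theta_0,\dots,\theta_3,\xi^1,\xi^2,\xi^3,\sigma_{11},\sigma_{12},\sigma_{13},\sigma_{22},\sigma_{23},\eta_1,\dots,\eta_8$, and let $H^2_{\lambda\zeta}(\mathfrak g_1)\cap I$ be the space of those classes in $H^2_{\lambda\zeta}(\mathfrak g_1)$ that are represented by a $d_{\lambda\zeta}$-closed 2-form in $I$. Then $H^1(\mathfrak g_1)=\mathbb R\,\zeta$ with $\zeta=3\eta_1+\eta_2\neq0$, and $$\dim\bigl(H^2_{\lambda\zeta}(\mathfrak g_1)\cap I\bigr)=\begin{cases}0,&\lambda\neq-\tfrac14,\\1,&\lambda=-\tfrac14.\end{cases}$$ Moreover $H^2_{-\frac14\zeta}(\mathfrak g_1)\cap I=\mathbb R\,[\Omega]$, where $$\Omega=\tfrac14(\eta_1-\eta_2-4\eta_3)\wedge(\xi^1+\xi^2+\xi^3)+\theta_2\wedge(\xi^1+\xi^3)+\theta_3\wedge\xi^1$$ is a $d_{-\frac14\zeta}$-closed 2-form in $I$. -/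

import Mathlib

open scoped Polynomial

noncomputable section

/-! ## Lie algebra cochains of low degree and the deformed differential -/

namespace LieForms

variable {L : Type*} [LieRing L] [LieAlgebra ℝ L]

variable (L) in
/-- The skew-symmetric bilinear maps `L × L → ℝ`. -/
def twoForms : Submodule ℝ (L →ₗ[ℝ] L →ₗ[ℝ] ℝ) where
  carrier := {c | ∀ X, c X X = 0}
  add_mem' {a b} ha hb X := by simp [ha X, hb X]
  zero_mem' := by simp
  smul_mem' t {c} hc X := by simp [hc X]

variable (L) in
/-- The 2-forms on `L`. (The 1-forms on `L` are the elements of `Module.Dual ℝ L`.) -/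
def TwoForm : Type _ := twoForms L

set_option maxSynthPendingDepth 3 in
instance : AddCommGroup (TwoForm L) := inferInstanceAs (AddCommGroup (twoForms L))

instance : Module ℝ (TwoForm L) := inferInstanceAs (Module ℝ (twoForms L))

instance : FunLike (TwoForm L) L (L → ℝ) where
  coe Θ X Y := Θ.1 X Y
  coe_injective _ _ h := Subtype.ext (LinearMap.ext₂ fun X Y => congrFun (congrFun h X) Y)

/-- The 2-form with the given values. -/
def TwoForm.mk (F : L → L → ℝ) (h₁ : ∀ X X' Y, F (X + X') Y = F X Y + F X' Y)
    (h₂ : ∀ (c : ℝ) X Y, F (c • X) Y = c * F X Y) (h₃ : ∀ X Y, F X Y = -F Y X) : TwoForm L :=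
  ⟨LinearMap.mk₂ ℝ F h₁ h₂
    (fun X Y Y' => by rw [h₃ X (Y + Y'), h₁, h₃ X Y, h₃ X Y']; ring)
    (fun c X Y => by rw [h₃ X (c • Y), h₂, h₃ X Y, smul_eq_mul]; ring),
   fun X => by have := h₃ X X; simp only [LinearMap.mk₂_apply]; linarith⟩

namespace TwoForm

@[ext] theorem ext {Θ Ψ : TwoForm L} (h : ∀ X Y, Θ X Y = Ψ X Y) : Θ = Ψ :=
  DFunLike.ext _ _ fun X => funext (h X)

@[simp] theorem mk_apply (F : L → L → ℝ) (h₁ h₂ h₃) (X Y : L) : mk F h₁ h₂ h₃ X Y = F X Y := rfl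
@[simp] theorem zero_apply (X Y : L) : (0 : TwoForm L) X Y = 0 := rfl
@[simp] theorem add_apply (Θ Ψ : TwoForm L) (X Y : L) : (Θ + Ψ) X Y = Θ X Y + Ψ X Y := rfl
@[simp] theorem neg_apply (Θ : TwoForm L) (X Y : L) : (-Θ) X Y = -Θ X Y := rfl
@[simp] theorem sub_apply (Θ Ψ : TwoForm L) (X Y : L) : (Θ - Ψ) X Y = Θ X Y - Ψ X Y := rfl
@[simp] theorem smul_apply (c : ℝ) (Θ : TwoForm L) (X Y : L) : (c • Θ) X Y = c * Θ X Y := rfl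

end TwoForm

/-- The differential on 1-forms, `dθ(X, Y) = -θ([X, Y])`. -/
def d₁ : Module.Dual ℝ L →ₗ[ℝ] TwoForm L where
  toFun θ := TwoForm.mk (fun X Y => -θ ⁅X, Y⁆)
    (fun _ _ _ => by simp only [add_lie, map_add]; ring)
    (fun _ _ _ => by simp only [smul_lie, map_smul, smul_eq_mul]; ring)
    (fun X Y => by rw [← lie_skew X Y, map_neg])
  map_add' _ _ := TwoForm.ext fun _ _ => by simp; ring
  map_smul' _ _ := TwoForm.ext fun _ _ => by simp

/-- The differential on 2-forms,
`dΘ(X, Y, Z) = -Θ([X, Y], Z) + Θ([X, Z], Y) - Θ([Y, Z], X)`. -/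
def d₂ : TwoForm L →ₗ[ℝ] L → L → L → ℝ where
  toFun Θ X Y Z := -Θ ⁅X, Y⁆ Z + Θ ⁅X, Z⁆ Y - Θ ⁅Y, Z⁆ X
  map_add' _ _ := by ext; simp; ring
  map_smul' _ _ := by ext; simp; ring

/-- The wedge product of two 1-forms, `(α ∧ β)(X, Y) = α(X) β(Y) - α(Y) β(X)`. -/
def wedge : Module.Dual ℝ L →ₗ[ℝ] Module.Dual ℝ L →ₗ[ℝ] TwoForm L :=
  LinearMap.mk₂ ℝ
    (fun α β => TwoForm.mk (fun X Y => α X * β Y - α Y * β X)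
        (fun _ _ _ => by simp only [map_add]; ring)
        (fun _ _ _ => by simp only [map_smul, smul_eq_mul]; ring)
        (fun _ _ => by ring))
    (fun _ _ _ => TwoForm.ext fun _ _ => by simp; ring)
    (fun _ _ _ => TwoForm.ext fun _ _ => by simp; ring)
    (fun _ _ _ => TwoForm.ext fun _ _ => by simp; ring)
    (fun _ _ _ => TwoForm.ext fun _ _ => by simp; ring)

theorem d₁_apply (θ : Module.Dual ℝ L) (X Y : L) : d₁ θ X Y = -θ ⁅X, Y⁆ := rfl

infixl:72 " ⋏ " => wedge

theorem wedge_apply (α β : Module.Dual ℝ L) (X Y : L) :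
    (α ⋏ β) X Y = α X * β Y - α Y * β X := rfl

/-- The wedge product of a 1-form and a 2-form,
`(α ∧ Θ)(X, Y, Z) = α(X) Θ(Y, Z) - α(Y) Θ(X, Z) + α(Z) Θ(X, Y)`. -/
def wedge₁₂ (α : Module.Dual ℝ L) : TwoForm L →ₗ[ℝ] L → L → L → ℝ where
  toFun Θ X Y Z := α X * Θ Y Z - α Y * Θ X Z + α Z * Θ X Y
  map_add' _ _ := by ext; simp; ring
  map_smul' _ _ := by ext; simp; ring

/-- The deformed differential `d_{ω} θ = dθ + ω ∧ θ` on 1-forms. -/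
def dDef₁ (ω : Module.Dual ℝ L) : Module.Dual ℝ L →ₗ[ℝ] TwoForm L :=
  d₁ + wedge ω

/-- The deformed differential `d_{ω} Θ = dΘ + ω ∧ Θ` on 2-forms. -/
def dDef₂ (ω : Module.Dual ℝ L) : TwoForm L →ₗ[ℝ] L → L → L → ℝ :=
  d₂ + wedge₁₂ ω

variable (L) in
/-- The first cohomology with trivial coefficients: the closed 1-forms (the differential
`C⁰ = ℝ → C¹` of the trivial representation is zero). -/
def H1 : Submodule ℝ (Module.Dual ℝ L) := LinearMap.ker d₁

/-- The 2-cocycles of the deformed complex. -/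
def Z2 (ω : Module.Dual ℝ L) : Submodule ℝ (TwoForm L) := LinearMap.ker (dDef₂ ω)

/-- The 2-coboundaries of the deformed complex. -/
def B2 (ω : Module.Dual ℝ L) : Submodule ℝ (TwoForm L) := LinearMap.range (dDef₁ ω)

/-- For a closed 1-form `ω` the deformed differential squares to zero. -/
theorem B2_le_Z2 {ω : Module.Dual ℝ L} (hω : ω ∈ H1 L) : B2 ω ≤ Z2 ω := by
  rintro _ ⟨θ, rfl⟩
  have hc : ∀ X Y : L, ω ⁅X, Y⁆ = 0 := fun X Y => by
    have h : d₁ ω X Y = 0 := by rw [show d₁ ω = 0 from hω]; rfl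
    rw [d₁_apply] at h
    linarith
  change d₂ (dDef₁ ω θ) + wedge₁₂ ω (dDef₁ ω θ) = 0
  funext X Y Z
  have hJ : θ ⁅⁅X, Y⁆, Z⁆ - θ ⁅⁅X, Z⁆, Y⁆ + θ ⁅⁅Y, Z⁆, X⁆ = 0 := by
    rw [← map_sub, ← map_add, lie_lie X Y Z, ← lie_skew ⁅Y, Z⁆ X, ← lie_skew ⁅X, Z⁆ Y,
      sub_neg_eq_add, sub_add_cancel, add_neg_cancel, map_zero]
  change -(-θ ⁅⁅X, Y⁆, Z⁆ + (ω ⁅X, Y⁆ * θ Z - ω Z * θ ⁅X, Y⁆))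
      + (-θ ⁅⁅X, Z⁆, Y⁆ + (ω ⁅X, Z⁆ * θ Y - ω Y * θ ⁅X, Z⁆))
      - (-θ ⁅⁅Y, Z⁆, X⁆ + (ω ⁅Y, Z⁆ * θ X - ω X * θ ⁅Y, Z⁆))
    + (ω X * (-θ ⁅Y, Z⁆ + (ω Y * θ Z - ω Z * θ Y))
      - ω Y * (-θ ⁅X, Z⁆ + (ω X * θ Z - ω Z * θ X))
      + ω Z * (-θ ⁅X, Y⁆ + (ω X * θ Y - ω Y * θ X))) = 0
  simp only [hc]
  linear_combination hJ

/-- The second deformed cohomology `H²_ω`. -/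
abbrev H2 (ω : Module.Dual ℝ L) : Type _ := Z2 ω ⧸ (B2 ω).submoduleOf (Z2 ω)

/-- The cohomology class of a deformed 2-cocycle. -/
def H2.cls (ω : Module.Dual ℝ L) : Z2 ω →ₗ[ℝ] H2 ω := ((B2 ω).submoduleOf (Z2 ω)).mkQ

/-- The degree 2 part of the exterior ideal generated by a set `S` of 1-forms. -/
def ideal₂ (S : Set (Module.Dual ℝ L)) : Submodule ℝ (TwoForm L) :=
  Submodule.span ℝ {Θ | ∃ α ∈ S, ∃ β : Module.Dual ℝ L, Θ = α ⋏ β}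

/-- The part of `H²_ω` lying in the exterior ideal generated by `S`: the classes of the deformed
2-cocycles that belong to the ideal. -/
def H2.inIdeal (ω : Module.Dual ℝ L) (S : Set (Module.Dual ℝ L)) : Submodule ℝ (H2 ω) :=
  ((ideal₂ S).submoduleOf (Z2 ω)).map (H2.cls ω)

/-- `Λ²` of a space of 1-forms, inside the 2-forms. -/
def sq (V : Submodule ℝ (Module.Dual ℝ L)) : Submodule ℝ (TwoForm L) :=
  Submodule.span ℝ {Θ | ∃ α ∈ V, ∃ β ∈ V, Θ = α ⋏ β}

/-! ## Normal prolongation -/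

section Prolongation

variable {ι κ : Type*} [Fintype ι] [Fintype κ]

/-- The span of the forms `ω` and of the first `n` generations of the forms `π`. -/
def level (ω : ι → Module.Dual ℝ L) (π : ℕ → κ → Module.Dual ℝ L) (n : ℕ) :
    Submodule ℝ (Module.Dual ℝ L) :=
  Submodule.span ℝ (Set.range ω ∪ {φ | ∃ m < n, ∃ c, φ = π m c})

/-- The new forms `π^c` enter the equations `dφ^i = A^i_{cj} π^c ∧ ω^j + …` normally: the
replacements `π^c ↦ π^c + z^c_j ω^j` that do not change these equations are exactly
`z^c_j = ∑_e W^c_{ej} v_e`, with `v` unique. Here `W` is the tableau with which the next generation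
`χ^e` of new forms enters the equations `dπ^c = W^c_{ej} χ^e ∧ ω^j + …`: there is one new form for
each free parameter of the replacement. -/
def NormalStep {μ : Type*} (ω : ι → Module.Dual ℝ L) (A : μ → κ → ι → ℝ) (W : κ → κ → ι → ℝ) :
    Prop :=
  (∀ z : κ → ι → ℝ,
    (∀ i, ∑ c, ∑ j, A i c j • ((∑ k, z c k • ω k) ⋏ ω j) = 0) ↔
      ∃ v : κ → ℝ, ∀ c j, z c j = ∑ e, W c e j * v e) ∧
  ∀ v : κ → ℝ, (∀ c j, ∑ e, W c e j * v e = 0) → v = 0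

/-- The Lie algebra `L` with the 1-forms `ω^i` and `π_n^c` (`n = 0, 1, 2, …`) is the (infinite)
normal prolongation of the structure equations of the `ω^i` with the new forms `π_0^c`:
* the forms are the coordinates of a basis of `L`, that is, `L` is spanned by the vectors dual
  to the forms;
* `dω^i = A^i_{cj} π_0^c ∧ ω^j` modulo products of forms `ω`;
* `dπ_n^c = W^c_{ej} π_{n+1}^e ∧ ω^j` modulo products of forms of generation at most `n`;
* at each step the new forms correspond to the free parameters, see `NormalStep`. -/
def IsNormalProlongation (ω : ι → Module.Dual ℝ L) (π : ℕ → κ → Module.Dual ℝ L) : Prop :=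
  (∃ b : Module.Basis (ι ⊕ ℕ × κ) ℝ L,
    (∀ i, b.coord (Sum.inl i) = ω i) ∧ ∀ n c, b.coord (Sum.inr (n, c)) = π n c) ∧
  ∃ (A : ι → κ → ι → ℝ) (W : ℕ → κ → κ → ι → ℝ),
    (∀ i, d₁ (ω i) - ∑ c, ∑ j, A i c j • (π 0 c ⋏ ω j) ∈ sq (level ω π 0)) ∧
    (∀ n c, d₁ (π n c) - ∑ e, ∑ j, W n c e j • (π (n + 1) e ⋏ ω j) ∈ sq (level ω π (n + 1))) ∧
    NormalStep ω A (W 0) ∧ ∀ n, NormalStep ω (W n) (W (n + 1))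

end Prolongation

end LieForms

/-! ## The Lie algebra -/

namespace PKhZ

open LieForms Polynomial

set_option linter.unusedSimpArgs false

/-- The Lie algebra `𝔤₁`, in the normal form in which its Jacobi identity is visible: a scaling
parameter `a` and five polynomials in `t`. -/
@[ext] structure G1 where
  a : ℝ
  f : ℝ[X]
  g : ℝ[X]
  h : ℝ[X]
  k : ℝ[X]
  l : ℝ[X]

namespace G1

instance : Zero G1 := ⟨⟨0, 0, 0, 0, 0, 0⟩⟩
instance : Add G1 := ⟨fun x y => ⟨x.a + y.a, x.f + y.f, x.g + y.g, x.h + y.h, x.k + y.k, x.l + y.l⟩⟩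
instance : Neg G1 := ⟨fun x => ⟨-x.a, -x.f, -x.g, -x.h, -x.k, -x.l⟩⟩
instance : SMul ℝ G1 := ⟨fun c x => ⟨c * x.a, c • x.f, c • x.g, c • x.h, c • x.k, c • x.l⟩⟩

@[simp] theorem zero_a : (0 : G1).a = 0 := rfl
@[simp] theorem zero_f : (0 : G1).f = 0 := rfl
@[simp] theorem zero_g : (0 : G1).g = 0 := rfl
@[simp] theorem zero_h : (0 : G1).h = 0 := rfl
@[simp] theorem zero_k : (0 : G1).k = 0 := rfl
@[simp] theorem zero_l : (0 : G1).l = 0 := rfl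
@[simp] theorem add_a (x y : G1) : (x + y).a = x.a + y.a := rfl
@[simp] theorem add_f (x y : G1) : (x + y).f = x.f + y.f := rfl
@[simp] theorem add_g (x y : G1) : (x + y).g = x.g + y.g := rfl
@[simp] theorem add_h (x y : G1) : (x + y).h = x.h + y.h := rfl
@[simp] theorem add_k (x y : G1) : (x + y).k = x.k + y.k := rfl
@[simp] theorem add_l (x y : G1) : (x + y).l = x.l + y.l := rfl
@[simp] theorem neg_a (x : G1) : (-x).a = -x.a := rfl
@[simp] theorem neg_f (x : G1) : (-x).f = -x.f := rfl
@[simp] theorem neg_g (x : G1) : (-x).g = -x.g := rfl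
@[simp] theorem neg_h (x : G1) : (-x).h = -x.h := rfl
@[simp] theorem neg_k (x : G1) : (-x).k = -x.k := rfl
@[simp] theorem neg_l (x : G1) : (-x).l = -x.l := rfl
@[simp] theorem smul_a (c : ℝ) (x : G1) : (c • x).a = c * x.a := rfl
@[simp] theorem smul_f (c : ℝ) (x : G1) : (c • x).f = c • x.f := rfl
@[simp] theorem smul_g (c : ℝ) (x : G1) : (c • x).g = c • x.g := rfl
@[simp] theorem smul_h (c : ℝ) (x : G1) : (c • x).h = c • x.h := rfl
@[simp] theorem smul_k (c : ℝ) (x : G1) : (c • x).k = c • x.k := rfl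
@[simp] theorem smul_l (c : ℝ) (x : G1) : (c • x).l = c • x.l := rfl

instance : AddCommGroup G1 where
  add_assoc _ _ _ := by ext1 <;> simp [add_assoc]
  zero_add _ := by ext1 <;> simp
  add_zero _ := by ext1 <;> simp
  nsmul := nsmulRec
  zsmul := zsmulRec
  neg_add_cancel _ := by ext1 <;> simp
  add_comm _ _ := by ext1 <;> simp [add_comm]

instance : Module ℝ G1 where
  one_smul _ := by ext1 <;> simp
  mul_smul _ _ _ := by ext1 <;> simp [mul_smul, mul_assoc]
  smul_zero _ := by ext1 <;> simp
  smul_add _ _ _ := by ext1 <;> simp [mul_add]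
  add_smul _ _ _ := by ext1 <;> simp [add_smul, add_mul]
  zero_smul _ := by ext1 <;> simp

instance : Bracket G1 G1 where
  bracket x y :=
    { a := 0
      f := x.f * derivative y.f - y.f * derivative x.f
      g := (x.f * derivative y.g - y.f * derivative x.g)
        - C (2 / 3) * (derivative x.f * y.g - derivative y.f * x.g)
        - (C x.a * y.g - C y.a * x.g)
      h := (x.f * derivative y.h - y.f * derivative x.h)
        - C (1 / 3) * (derivative x.f * y.h - derivative y.f * x.h)
        - C 2 * (C x.a * y.h - C y.a * x.h)
        + C (1 / 2) * (x.g * derivative y.g - y.g * derivative x.g)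
      k := (x.f * derivative y.k - y.f * derivative x.k)
        + (derivative x.f * y.k - derivative y.f * x.k)
        - C 3 * (C x.a * y.k - C y.a * x.k)
        + C (1 / 2) * (derivative (derivative x.g) * y.h - derivative (derivative y.g) * x.h)
        - C (1 / 2) * (derivative x.g * derivative y.h - derivative y.g * derivative x.h)
        - (x.g * derivative (derivative y.h) - y.g * derivative (derivative x.h))
      l := (x.f * derivative y.l - y.f * derivative x.l)
        + C (1 / 3) * (derivative x.f * y.l - derivative y.f * x.l)
        - C 4 * (C x.a * y.l - C y.a * x.l)
        + (x.h * derivative y.h - y.h * derivative x.h)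
        - (x.g * y.k - y.g * x.k) }

@[simp] theorem lie_a (x y : G1) : ⁅x, y⁆.a = 0 := rfl
theorem lie_f (x y : G1) : ⁅x, y⁆.f = x.f * derivative y.f - y.f * derivative x.f := rfl
theorem lie_g (x y : G1) : ⁅x, y⁆.g = (x.f * derivative y.g - y.f * derivative x.g)
        - C (2 / 3) * (derivative x.f * y.g - derivative y.f * x.g)
        - (C x.a * y.g - C y.a * x.g) := rfl
theorem lie_h (x y : G1) : ⁅x, y⁆.h = (x.f * derivative y.h - y.f * derivative x.h)
        - C (1 / 3) * (derivative x.f * y.h - derivative y.f * x.h)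
        - C 2 * (C x.a * y.h - C y.a * x.h)
        + C (1 / 2) * (x.g * derivative y.g - y.g * derivative x.g) := rfl
theorem lie_k (x y : G1) : ⁅x, y⁆.k = (x.f * derivative y.k - y.f * derivative x.k)
        + (derivative x.f * y.k - derivative y.f * x.k)
        - C 3 * (C x.a * y.k - C y.a * x.k)
        + C (1 / 2) * (derivative (derivative x.g) * y.h - derivative (derivative y.g) * x.h)
        - C (1 / 2) * (derivative x.g * derivative y.h - derivative y.g * derivative x.h)
        - (x.g * derivative (derivative y.h) - y.g * derivative (derivative x.h)) := rfl
theorem lie_l (x y : G1) : ⁅x, y⁆.l = (x.f * derivative y.l - y.f * derivative x.l)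
        + C (1 / 3) * (derivative x.f * y.l - derivative y.f * x.l)
        - C 4 * (C x.a * y.l - C y.a * x.l)
        + (x.h * derivative y.h - y.h * derivative x.h)
        - (x.g * y.k - y.g * x.k) := rfl

instance : LieRing G1 where
  add_lie x y z := by
    ext1 <;> simp [lie_f, lie_g, lie_h, lie_k, lie_l] <;> ring
  lie_add x y z := by
    ext1 <;> simp [lie_f, lie_g, lie_h, lie_k, lie_l] <;> ring
  lie_self x := by
    ext1 <;> simp [lie_f, lie_g, lie_h, lie_k, lie_l]
  leibniz_lie x y z := by
    ext1
    · simp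
    all_goals
      refine Polynomial.funext fun t => ?_
      simp only [add_f, add_g, add_h, add_k, add_l, lie_f, lie_g, lie_h, lie_k, lie_l, lie_a,
        derivative_add, derivative_sub, derivative_mul, derivative_C, C_0, eval_add, eval_sub,
        eval_mul, eval_C, eval_neg, zero_mul, zero_add, sub_zero, zero_sub]
      ring

instance : LieAlgebra ℝ G1 where
  lie_smul c x y := by
    ext1 <;> simp [lie_f, lie_g, lie_h, lie_k, lie_l, smul_eq_C_mul] <;> ring

/-- The components of an element, as linear maps. -/
def fₗ : G1 →ₗ[ℝ] ℝ[X] := ⟨⟨f, fun _ _ => rfl⟩, fun _ _ => rfl⟩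
/-- See `fₗ`. -/
def gₗ : G1 →ₗ[ℝ] ℝ[X] := ⟨⟨g, fun _ _ => rfl⟩, fun _ _ => rfl⟩
/-- See `fₗ`. -/
def hₗ : G1 →ₗ[ℝ] ℝ[X] := ⟨⟨h, fun _ _ => rfl⟩, fun _ _ => rfl⟩
/-- See `fₗ`. -/
def kₗ : G1 →ₗ[ℝ] ℝ[X] := ⟨⟨k, fun _ _ => rfl⟩, fun _ _ => rfl⟩
/-- See `fₗ`. -/
def lₗ : G1 →ₗ[ℝ] ℝ[X] := ⟨⟨l, fun _ _ => rfl⟩, fun _ _ => rfl⟩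

end G1

open G1

/-- The `m`-th derivative at `t = 0` of a polynomial component. -/
def jet (p : G1 →ₗ[ℝ] ℝ[X]) (m : ℕ) : Module.Dual ℝ G1 where
  toFun X := (derivative^[m] (p X)).eval 0
  map_add' X Y := by simp [iterate_map_add]
  map_smul' c X := by simp [iterate_derivative_smul]

/-- The coordinate 1-forms on `𝔤₁`: the scaling parameter and the derivatives at `t = 0` of the five
polynomials. -/
def α : Module.Dual ℝ G1 := ⟨⟨G1.a, fun _ _ => rfl⟩, fun _ _ => rfl⟩
/-- See `α`. -/
def F (m : ℕ) : Module.Dual ℝ G1 := jet fₗ m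
/-- See `α`. -/
def G (m : ℕ) : Module.Dual ℝ G1 := jet gₗ m
/-- See `α`. -/
def H (m : ℕ) : Module.Dual ℝ G1 := jet hₗ m
/-- See `α`. -/
def K (m : ℕ) : Module.Dual ℝ G1 := jet kₗ m
/-- See `α`. -/
def L (m : ℕ) : Module.Dual ℝ G1 := jet lₗ m

theorem α_apply (X : G1) : α X = X.a := rfl
theorem F_apply (m : ℕ) (X : G1) : F m X = (derivative^[m] X.f).eval 0 := rfl
theorem G_apply (m : ℕ) (X : G1) : G m X = (derivative^[m] X.g).eval 0 := rfl
theorem H_apply (m : ℕ) (X : G1) : H m X = (derivative^[m] X.h).eval 0 := rfl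
theorem K_apply (m : ℕ) (X : G1) : K m X = (derivative^[m] X.k).eval 0 := rfl
theorem L_apply (m : ℕ) (X : G1) : L m X = (derivative^[m] X.l).eval 0 := rfl

/-! The Maurer–Cartan forms of the symmetry pseudo-group of `u_yy = u_tx + u_x u_xx`. -/

def θ₀ : Module.Dual ℝ G1 := L 0
def θ₁ : Module.Dual ℝ G1 := -L 1
def θ₂ : Module.Dual ℝ G1 := -H 1
def θ₃ : Module.Dual ℝ G1 := K 0
def ξ₁ : Module.Dual ℝ G1 := F 0
def ξ₂ : Module.Dual ℝ G1 := H 0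
def ξ₃ : Module.Dual ℝ G1 := G 0
def σ₁₁ : Module.Dual ℝ G1 := L 2
def σ₁₂ : Module.Dual ℝ G1 := H 2
def σ₁₃ : Module.Dual ℝ G1 := -K 1
def σ₂₂ : Module.Dual ℝ G1 := (1 / 3 : ℝ) • F 2 - H 0
def σ₂₃ : Module.Dual ℝ G1 := (1 / 2 : ℝ) • G 2
def η₁ : Module.Dual ℝ G1 := (4 : ℝ) • α - (1 / 3 : ℝ) • F 1
def η₂ : Module.Dual ℝ G1 := F 1
def η₃ : Module.Dual ℝ G1 := (1 / 2 : ℝ) • G 1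
def η₄ : Module.Dual ℝ G1 := (1 / 3 : ℝ) • F 3 - H 1
def η₅ : Module.Dual ℝ G1 := (1 / 2 : ℝ) • G 3
def η₆ : Module.Dual ℝ G1 := H 3
def η₇ : Module.Dual ℝ G1 := -K 2
def η₈ : Module.Dual ℝ G1 := L 3
def η₉ : Module.Dual ℝ G1 := (1 / 3 : ℝ) • F 4 - H 2
def η₁₀ : Module.Dual ℝ G1 := (1 / 2 : ℝ) • G 4
def η₁₁ : Module.Dual ℝ G1 := H 4
def η₁₂ : Module.Dual ℝ G1 := -K 3
def η₁₃ : Module.Dual ℝ G1 := L 4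

/-- The Maurer–Cartan forms whose differentials the structure equations give. -/
def baseForms : Fin 20 → Module.Dual ℝ G1 :=
  ![θ₀, θ₁, θ₂, θ₃, ξ₁, ξ₂, ξ₃, σ₁₁, σ₁₂, σ₁₃, σ₂₂, σ₂₃, η₁, η₂, η₃, η₄, η₅, η₆, η₇, η₈]

/-- The new forms of the `n`-th prolongation, `η₉₊₅ₙ, …, η₁₃₊₅ₙ`; those of the structure equations
themselves are `n = 0`. -/
def newForms (n : ℕ) : Fin 5 → Module.Dual ℝ G1 :=
  ![(1 / 3 : ℝ) • F (n + 4) - H (n + 2), (1 / 2 : ℝ) • G (n + 4), H (n + 4), -K (n + 3), L (n + 4)]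

theorem newForms_zero : newForms 0 = ![η₉, η₁₀, η₁₁, η₁₂, η₁₃] := rfl

/-- The structure equations of the symmetry pseudo-group of `u_yy = u_tx + u_x u_xx`. -/
def StructureEquations : Prop :=
  d₁ θ₀ = η₁ ⋏ θ₀ + ξ₁ ⋏ θ₁ + ξ₂ ⋏ θ₂ + ξ₃ ⋏ θ₃ ∧
  d₁ θ₁ = (η₁ - η₂) ⋏ θ₁ - (2 : ℝ) • (η₃ ⋏ θ₃) - θ₀ ⋏ (ξ₂ + σ₂₂) + ξ₁ ⋏ σ₁₁ + ξ₂ ⋏ σ₁₂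
    + ξ₃ ⋏ σ₁₃ ∧
  d₁ θ₂ = (1 / 2 : ℝ) • ((η₁ - η₂) ⋏ θ₂) + ξ₁ ⋏ σ₁₂ + ξ₂ ⋏ σ₂₂ + ξ₃ ⋏ σ₂₃ ∧
  d₁ θ₃ = (3 / 4 : ℝ) • ((η₁ - η₂) ⋏ θ₃) - η₃ ⋏ θ₂ + ξ₁ ⋏ σ₁₃ + ξ₂ ⋏ σ₂₃ + ξ₃ ⋏ σ₁₂ ∧
  d₁ ξ₁ = η₂ ⋏ ξ₁ ∧
  d₁ ξ₂ = (1 / 2 : ℝ) • ((η₁ + η₂) ⋏ ξ₂) + η₃ ⋏ ξ₃ - θ₂ ⋏ ξ₁ ∧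
  d₁ ξ₃ = (1 / 4 : ℝ) • ((η₁ + (3 : ℝ) • η₂) ⋏ ξ₃) + (2 : ℝ) • (η₃ ⋏ ξ₁) ∧
  d₁ σ₁₁ = (η₁ - (2 : ℝ) • η₂) ⋏ σ₁₁ - (4 : ℝ) • (η₃ ⋏ σ₁₃) - (η₄ - θ₂) ⋏ θ₀ + η₆ ⋏ ξ₂
    + η₇ ⋏ ξ₃ + η₈ ⋏ ξ₁ - (5 : ℝ) • (θ₁ ⋏ (ξ₂ + σ₂₂)) + θ₂ ⋏ σ₁₂ - (2 : ℝ) • (θ₃ ⋏ σ₂₃) ∧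
  d₁ σ₁₂ = (1 / 2 : ℝ) • ((η₁ - (3 : ℝ) • η₂) ⋏ σ₁₂) - (2 : ℝ) • (η₃ ⋏ σ₂₃) + η₄ ⋏ ξ₂ + η₅ ⋏ ξ₃
    + η₆ ⋏ ξ₁ - θ₂ ⋏ ((2 : ℝ) • ξ₂ + σ₂₂) ∧
  d₁ σ₁₃ = (1 / 4 : ℝ) • (((3 : ℝ) • η₁ - (7 : ℝ) • η₂) ⋏ σ₁₃) - (3 : ℝ) • (η₃ ⋏ σ₁₂) + η₅ ⋏ ξ₂
    + η₆ ⋏ ξ₃ + η₇ ⋏ ξ₁ - (3 : ℝ) • (θ₃ ⋏ (ξ₂ + σ₂₂)) ∧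
  d₁ σ₂₂ = η₄ ⋏ ξ₁ - (1 / 2 : ℝ) • (η₁ ⋏ ξ₂)
    - (1 / 2 : ℝ) • (η₂ ⋏ ((3 : ℝ) • ξ₂ + (2 : ℝ) • σ₂₂)) - η₃ ⋏ ξ₃ ∧
  d₁ σ₂₃ = (1 / 4 : ℝ) • ((η₁ - (5 : ℝ) • η₂) ⋏ σ₂₃) - η₃ ⋏ (ξ₂ + σ₂₂) + (η₄ - θ₂) ⋏ ξ₃
    + η₅ ⋏ ξ₁ ∧
  d₁ η₁ = ξ₁ ⋏ (ξ₂ + σ₂₂) ∧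
  d₁ η₂ = -(3 : ℝ) • (ξ₁ ⋏ (ξ₂ + σ₂₂)) ∧
  d₁ η₃ = (1 / 4 : ℝ) • ((η₁ - η₂) ⋏ η₃) + σ₂₃ ⋏ ξ₁ - ξ₃ ⋏ (ξ₂ + σ₂₂) ∧
  d₁ η₄ = η₉ ⋏ ξ₁ + (1 / 2 : ℝ) • (η₂ ⋏ ((3 : ℝ) • θ₂ - (4 : ℝ) • η₄) + η₁ ⋏ θ₂) + ξ₂ ⋏ σ₂₂
    + ξ₃ ⋏ σ₂₃ ∧
  d₁ η₅ = η₉ ⋏ ξ₃ + η₁₀ ⋏ ξ₁ + (1 / 4 : ℝ) • ((η₁ - (9 : ℝ) • η₂) ⋏ η₅)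
    - (3 : ℝ) • (η₃ ⋏ (η₄ - θ₂)) + σ₁₂ ⋏ ξ₃ + (3 : ℝ) • (σ₂₃ ⋏ (ξ₂ + σ₂₂)) ∧
  d₁ η₆ = η₉ ⋏ ξ₂ + η₁₀ ⋏ ξ₃ + η₁₁ ⋏ ξ₁ + (1 / 2 : ℝ) • ((η₁ - (5 : ℝ) • η₂) ⋏ η₆)
    - (4 : ℝ) • (η₃ ⋏ η₅) + σ₁₂ ⋏ ((7 : ℝ) • ξ₂ + (6 : ℝ) • σ₂₂) ∧
  d₁ η₇ = η₁₀ ⋏ ξ₂ + η₁₁ ⋏ ξ₃ + η₁₂ ⋏ ξ₁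
    + (1 / 4 : ℝ) • (((3 : ℝ) • η₁ - (11 : ℝ) • η₂) ⋏ η₇) - (5 : ℝ) • (η₃ ⋏ η₆)
    + (3 : ℝ) • (η₄ ⋏ θ₃) - (η₅ - (3 : ℝ) • θ₃) ⋏ θ₂ + (3 : ℝ) • (σ₁₂ ⋏ σ₂₃)
    + (9 : ℝ) • (σ₁₃ ⋏ (ξ₂ + σ₂₂)) ∧
  d₁ η₈ = (η₁ - (3 : ℝ) • η₂) ⋏ η₈ + (6 : ℝ) • (η₄ ⋏ θ₁ - η₃ ⋏ η₇ + σ₁₃ ⋏ σ₂₃)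
    + (2 : ℝ) • (η₅ ⋏ θ₃) - (2 : ℝ) • ((η₆ - (3 : ℝ) • θ₁) ⋏ θ₂) - (η₉ + σ₁₂) ⋏ θ₀
    + η₁₁ ⋏ ξ₂ + η₁₂ ⋏ ξ₃ + η₁₃ ⋏ ξ₁ + (12 : ℝ) • (σ₁₁ ⋏ (ξ₂ + σ₂₂))

theorem structureEquations : StructureEquations := by
  refine ⟨?_, ?_, ?_, ?_, ?_, ?_, ?_, ?_, ?_, ?_, ?_, ?_, ?_, ?_, ?_, ?_, ?_, ?_, ?_, ?_⟩ <;>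
    refine TwoForm.ext fun X Y => ?_ <;>
    simp only [θ₀, θ₁, θ₂, θ₃, ξ₁, ξ₂, ξ₃, σ₁₁, σ₁₂, σ₁₃, σ₂₂, σ₂₃, η₁, η₂, η₃, η₄, η₅, η₆, η₇, η₈,
      η₉, η₁₀, η₁₁, η₁₂, η₁₃, d₁_apply, wedge_apply, TwoForm.add_apply, TwoForm.sub_apply,
      TwoForm.smul_apply, LinearMap.add_apply, LinearMap.sub_apply,
      LinearMap.neg_apply, LinearMap.smul_apply, smul_eq_mul, α_apply, F_apply, G_apply, H_apply,
      K_apply, L_apply, lie_a, lie_f, lie_g, lie_h, lie_k, lie_l, Function.iterate_succ,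
      Function.iterate_zero, Function.comp_apply, id_eq, derivative_add, derivative_sub,
      derivative_mul, derivative_C, zero_mul, zero_add, eval_add, eval_sub, eval_mul, eval_C] <;>
    ring

/-! ### The tower of prolongations -/

/-- The components of the derivative. -/
def dₗ (p : G1 →ₗ[ℝ] ℝ[X]) : G1 →ₗ[ℝ] ℝ[X] := derivative ∘ₗ p

theorem jet_dₗ (p : G1 →ₗ[ℝ] ℝ[X]) (m : ℕ) : jet (dₗ p) m = jet p (m + 1) := rfl

/-- The `m`-th derivative at `t = 0` of `p(X) q(Y) - p(Y) q(X)`. -/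
def jetWedge (p q : G1 →ₗ[ℝ] ℝ[X]) (m : ℕ) : TwoForm G1 :=
  ∑ i ∈ Finset.range (m + 1), (m.choose i : ℝ) • (jet p (m - i) ⋏ jet q i)

theorem TwoForm.sum_apply {ι : Type*} (s : Finset ι) (f : ι → TwoForm G1) (X Y : G1) :
    (∑ i ∈ s, f i) X Y = ∑ i ∈ s, f i X Y := by
  classical
  induction s using Finset.induction_on with
  | empty => simp
  | insert a s ha ih => rw [Finset.sum_insert ha, Finset.sum_insert ha, TwoForm.add_apply, ih]

theorem jetWedge_apply (p q : G1 →ₗ[ℝ] ℝ[X]) (m : ℕ) (X Y : G1) :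
    jetWedge p q m X Y = (derivative^[m] (p X * q Y - p Y * q X)).eval 0 := by
  rw [jetWedge, TwoForm.sum_apply, iterate_derivative_sub, iterate_derivative_mul,
    iterate_derivative_mul, ← Finset.sum_sub_distrib, eval_finsetSum]
  refine Finset.sum_congr rfl fun i _ => ?_
  simp only [TwoForm.smul_apply, wedge_apply, jet, LinearMap.coe_mk, AddHom.coe_mk, eval_sub,
    nsmul_eq_mul, eval_mul, eval_natCast]
  ring

theorem wedge_mem_sq {U : Submodule ℝ (Module.Dual ℝ G1)} {a b : Module.Dual ℝ G1} (ha : a ∈ U)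
    (hb : b ∈ U) : a ⋏ b ∈ sq U := Submodule.subset_span ⟨a, ha, b, hb, rfl⟩

theorem jetWedge_mem {U : Submodule ℝ (Module.Dual ℝ G1)} {p q : G1 →ₗ[ℝ] ℝ[X]} {m : ℕ}
    (hp : ∀ i ≤ m, jet p i ∈ U) (hq : ∀ i ≤ m, jet q i ∈ U) : jetWedge p q m ∈ sq U :=
  Submodule.sum_mem _ fun i hi => Submodule.smul_mem _ _ <|
    wedge_mem_sq (hp _ (Nat.sub_le _ _)) (hq _ (by simpa [Nat.lt_succ_iff] using hi))

theorem jetWedge_right {U : Submodule ℝ (Module.Dual ℝ G1)} {p q : G1 →ₗ[ℝ] ℝ[X]} {m : ℕ}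
    (hp : ∀ i ≤ m, jet p i ∈ U) (hq : ∀ i < m, jet q i ∈ U) :
    jetWedge p q m - jet p 0 ⋏ jet q m ∈ sq U := by
  rw [jetWedge, Finset.sum_range_succ]
  simp only [Nat.choose_self, Nat.cast_one, one_smul, Nat.sub_self, add_sub_cancel_right]
  exact Submodule.sum_mem _ fun i hi => Submodule.smul_mem _ _ <|
    wedge_mem_sq (hp _ (Nat.sub_le _ _)) (hq _ (by simpa using hi))

theorem jetWedge_left {U : Submodule ℝ (Module.Dual ℝ G1)} {p q : G1 →ₗ[ℝ] ℝ[X]} {m : ℕ}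
    (hp : ∀ i < m, jet p i ∈ U) (hq : ∀ i ≤ m, jet q i ∈ U) :
    jetWedge p q m - jet p m ⋏ jet q 0 ∈ sq U := by
  rw [jetWedge, Finset.sum_range_succ']
  simp only [Nat.choose_zero_right, Nat.cast_one, one_smul, Nat.sub_zero, add_sub_cancel_right]
  refine Submodule.sum_mem _ fun i hi => Submodule.smul_mem _ _ <| ?_
  have := Finset.mem_range.1 hi
  exact wedge_mem_sq (hp _ (by omega)) (hq _ (by omega))

theorem d_F (m : ℕ) : d₁ (F m) = -jetWedge fₗ (dₗ fₗ) m := by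
  refine TwoForm.ext fun X Y => ?_
  rw [d₁_apply, TwoForm.neg_apply, jetWedge_apply]
  rfl

theorem d_G (m : ℕ) : d₁ (G m) = -jetWedge fₗ (dₗ gₗ) m + (2 / 3 : ℝ) • jetWedge (dₗ fₗ) gₗ m
    + α ⋏ G m := by
  refine TwoForm.ext fun X Y => ?_
  simp only [d₁_apply, TwoForm.neg_apply, TwoForm.add_apply, TwoForm.sub_apply,
    TwoForm.smul_apply, jetWedge_apply, wedge_apply, G_apply, lie_g, iterate_derivative_sub,
    iterate_map_add, iterate_derivative_C_mul, eval_sub, eval_add, eval_mul, eval_C, α_apply, fₗ,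
    gₗ, hₗ, kₗ, lₗ, dₗ, LinearMap.coe_mk, AddHom.coe_mk, LinearMap.comp_apply]
  ring

theorem d_H (m : ℕ) : d₁ (H m) = -jetWedge fₗ (dₗ hₗ) m + (1 / 3 : ℝ) • jetWedge (dₗ fₗ) hₗ m
    - (1 / 2 : ℝ) • jetWedge gₗ (dₗ gₗ) m + (2 : ℝ) • (α ⋏ H m) := by
  refine TwoForm.ext fun X Y => ?_
  simp only [d₁_apply, TwoForm.neg_apply, TwoForm.add_apply, TwoForm.sub_apply,
    TwoForm.smul_apply, jetWedge_apply, wedge_apply, H_apply, lie_h, iterate_derivative_sub,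
    iterate_map_add, iterate_derivative_C_mul, eval_sub, eval_add, eval_mul, eval_C, α_apply, fₗ,
    gₗ, hₗ, kₗ, lₗ, dₗ, LinearMap.coe_mk, AddHom.coe_mk, LinearMap.comp_apply]
  ring

theorem d_K (m : ℕ) : d₁ (K m) = -jetWedge fₗ (dₗ kₗ) m - jetWedge (dₗ fₗ) kₗ m
    - (1 / 2 : ℝ) • jetWedge (dₗ (dₗ gₗ)) hₗ m + (1 / 2 : ℝ) • jetWedge (dₗ gₗ) (dₗ hₗ) m
    + jetWedge gₗ (dₗ (dₗ hₗ)) m + (3 : ℝ) • (α ⋏ K m) := by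
  refine TwoForm.ext fun X Y => ?_
  simp only [d₁_apply, TwoForm.neg_apply, TwoForm.add_apply, TwoForm.sub_apply,
    TwoForm.smul_apply, jetWedge_apply, wedge_apply, K_apply, lie_k, iterate_derivative_sub,
    iterate_map_add, iterate_derivative_C_mul, eval_sub, eval_add, eval_mul, eval_C, α_apply, fₗ,
    gₗ, hₗ, kₗ, lₗ, dₗ, LinearMap.coe_mk, AddHom.coe_mk, LinearMap.comp_apply]
  ring

theorem d_L (m : ℕ) : d₁ (L m) = -jetWedge fₗ (dₗ lₗ) m - (1 / 3 : ℝ) • jetWedge (dₗ fₗ) lₗ m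
    - jetWedge hₗ (dₗ hₗ) m + jetWedge gₗ kₗ m + (4 : ℝ) • (α ⋏ L m) := by
  refine TwoForm.ext fun X Y => ?_
  simp only [d₁_apply, TwoForm.neg_apply, TwoForm.add_apply, TwoForm.sub_apply,
    TwoForm.smul_apply, jetWedge_apply, wedge_apply, L_apply, lie_l, iterate_derivative_sub,
    iterate_map_add, iterate_derivative_C_mul, eval_sub, eval_add, eval_mul, eval_C, α_apply, fₗ,
    gₗ, hₗ, kₗ, lₗ, dₗ, LinearMap.coe_mk, AddHom.coe_mk, LinearMap.comp_apply]
  ring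

/-! The forms of generation at most `n`. -/

section Levels

variable {n : ℕ}

/-- The span of the base forms and the first `m` generations of new forms. -/
abbrev lev (m : ℕ) : Submodule ℝ (Module.Dual ℝ G1) := level baseForms newForms m

theorem base_mem (m : ℕ) (i : Fin 20) : baseForms i ∈ lev m :=
  Submodule.subset_span (Or.inl ⟨i, rfl⟩)

theorem new_mem {m k : ℕ} (h : k < m) (c : Fin 5) : newForms k c ∈ lev m :=
  Submodule.subset_span (Or.inr ⟨k, h, c, rfl⟩)

theorem α_mem (m : ℕ) : α ∈ lev m := by
  have h : α = (1 / 4 : ℝ) • (baseForms 12 + (1 / 3 : ℝ) • baseForms 13) := by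
    change α = (1 / 4 : ℝ) • (η₁ + (1 / 3 : ℝ) • η₂)
    rw [η₁, η₂]; module
  rw [h]
  exact Submodule.smul_mem _ _ (Submodule.add_mem _ (base_mem _ _)
    (Submodule.smul_mem _ _ (base_mem _ _)))

theorem H_mem {m : ℕ} : ∀ k < m + 4, H k ∈ lev m
  | 0, _ => base_mem _ 5
  | 1, _ => by
    have h : H 1 = -baseForms 2 := (neg_neg (H 1)).symm
    rw [h]; exact Submodule.neg_mem _ (base_mem _ _)
  | 2, _ => base_mem _ 8
  | 3, _ => base_mem _ 17
  | k + 4, h => new_mem (k := k) (by omega) 2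

theorem F_mem {m : ℕ} : ∀ k < m + 4, F k ∈ lev m
  | 0, _ => base_mem _ 4
  | 1, _ => base_mem _ 13
  | 2, _ => by
    have h : F 2 = (3 : ℝ) • (baseForms 10 + baseForms 5) := by
      change F 2 = (3 : ℝ) • (σ₂₂ + ξ₂)
      rw [σ₂₂, ξ₂]; module
    rw [h]; exact Submodule.smul_mem _ _ (Submodule.add_mem _ (base_mem _ _) (base_mem _ _))
  | 3, _ => by
    have h : F 3 = (3 : ℝ) • (baseForms 15 + H 1) := by
      change F 3 = (3 : ℝ) • (η₄ + H 1)
      rw [η₄]; module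
    rw [h]; exact Submodule.smul_mem _ _ (Submodule.add_mem _ (base_mem _ _) (H_mem _ (by omega)))
  | k + 4, hk => by
    have h : F (k + 4) = (3 : ℝ) • (newForms k 0 + H (k + 2)) := by
      change F (k + 4) = (3 : ℝ) • ((1 / 3 : ℝ) • F (k + 4) - H (k + 2) + H (k + 2))
      module
    rw [h]
    exact Submodule.smul_mem _ _ (Submodule.add_mem _ (new_mem (by omega) _) (H_mem _ (by omega)))

theorem G_mem {m : ℕ} : ∀ k < m + 4, G k ∈ lev m
  | 0, _ => base_mem _ 6
  | 1, _ => by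
    have h : G 1 = (2 : ℝ) • baseForms 14 := by
      change G 1 = (2 : ℝ) • (1 / 2 : ℝ) • G 1
      module
    rw [h]; exact Submodule.smul_mem _ _ (base_mem _ _)
  | 2, _ => by
    have h : G 2 = (2 : ℝ) • baseForms 11 := by
      change G 2 = (2 : ℝ) • (1 / 2 : ℝ) • G 2
      module
    rw [h]; exact Submodule.smul_mem _ _ (base_mem _ _)
  | 3, _ => by
    have h : G 3 = (2 : ℝ) • baseForms 16 := by
      change G 3 = (2 : ℝ) • (1 / 2 : ℝ) • G 3
      module
    rw [h]; exact Submodule.smul_mem _ _ (base_mem _ _)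
  | k + 4, hk => by
    have h : G (k + 4) = (2 : ℝ) • newForms k 1 := by
      change G (k + 4) = (2 : ℝ) • (1 / 2 : ℝ) • G (k + 4)
      module
    rw [h]; exact Submodule.smul_mem _ _ (new_mem (by omega) _)

theorem K_mem {m : ℕ} : ∀ k < m + 3, K k ∈ lev m
  | 0, _ => base_mem _ 3
  | 1, _ => by
    have h : K 1 = -baseForms 9 := (neg_neg (K 1)).symm
    rw [h]; exact Submodule.neg_mem _ (base_mem _ _)
  | 2, _ => by
    have h : K 2 = -baseForms 18 := (neg_neg (K 2)).symm
    rw [h]; exact Submodule.neg_mem _ (base_mem _ _)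
  | k + 3, hk => by
    have h : K (k + 3) = -newForms k 3 := (neg_neg (K (k + 3))).symm
    rw [h]; exact Submodule.neg_mem _ (new_mem (by omega) _)

theorem L_mem {m : ℕ} : ∀ k < m + 4, L k ∈ lev m
  | 0, _ => base_mem _ 0
  | 1, _ => by
    have h : L 1 = -baseForms 1 := (neg_neg (L 1)).symm
    rw [h]; exact Submodule.neg_mem _ (base_mem _ _)
  | 2, _ => base_mem _ 7
  | 3, _ => base_mem _ 19
  | k + 4, h => new_mem (k := k) (by omega) 4

/-! Principal parts of the differentials. -/

/-- `jet` in the notation of the coordinate forms. -/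
theorem jet_eq : jet fₗ = F ∧ jet gₗ = G ∧ jet hₗ = H ∧ jet kₗ = K ∧ jet lₗ = L :=
  ⟨rfl, rfl, rfl, rfl, rfl⟩

theorem d_F_mod (n : ℕ) : d₁ (F (n + 4)) - F (n + 5) ⋏ F 0 ∈ sq (lev (n + 1)) := by
  have h₁ := jetWedge_right (U := lev (n + 1)) (p := fₗ) (q := dₗ fₗ) (m := n + 4)
    (fun i hi => F_mem i (by omega)) (fun i hi => F_mem (i + 1) (by omega))
  convert Submodule.neg_mem _ h₁ using 1
  rw [d_F]
  refine TwoForm.ext fun X Y => ?_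
  simp only [TwoForm.neg_apply, TwoForm.sub_apply, wedge_apply, jet_dₗ, jet_eq]
  ring

theorem d_G_mod (n : ℕ) : d₁ (G (n + 4)) - (G (n + 5) ⋏ F 0 + (2 / 3 : ℝ) • (F (n + 5) ⋏ G 0))
    ∈ sq (lev (n + 1)) := by
  have h₁ := jetWedge_right (U := lev (n + 1)) (p := fₗ) (q := dₗ gₗ) (m := n + 4)
    (fun i hi => F_mem i (by omega)) (fun i hi => G_mem (i + 1) (by omega))
  have h₂ := jetWedge_left (U := lev (n + 1)) (p := dₗ fₗ) (q := gₗ) (m := n + 4)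
    (fun i hi => F_mem (i + 1) (by omega)) (fun i hi => G_mem i (by omega))
  have h₃ := wedge_mem_sq (α_mem (n + 1)) (G_mem (m := n + 1) (n + 4) (by omega))
  convert Submodule.add_mem _ (Submodule.add_mem _ (Submodule.neg_mem _ h₁)
    (Submodule.smul_mem _ (2 / 3 : ℝ) h₂)) h₃ using 1
  rw [d_G]
  refine TwoForm.ext fun X Y => ?_
  simp only [TwoForm.neg_apply, TwoForm.sub_apply, TwoForm.add_apply, TwoForm.smul_apply,
    wedge_apply, jet_dₗ, jet_eq]
  ring

theorem d_H_mod (n : ℕ) : d₁ (H (n + 4)) - (H (n + 5) ⋏ F 0 + (1 / 3 : ℝ) • (F (n + 5) ⋏ H 0)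
    + (1 / 2 : ℝ) • (G (n + 5) ⋏ G 0)) ∈ sq (lev (n + 1)) := by
  have h₁ := jetWedge_right (U := lev (n + 1)) (p := fₗ) (q := dₗ hₗ) (m := n + 4)
    (fun i hi => F_mem i (by omega)) (fun i hi => H_mem (i + 1) (by omega))
  have h₂ := jetWedge_left (U := lev (n + 1)) (p := dₗ fₗ) (q := hₗ) (m := n + 4)
    (fun i hi => F_mem (i + 1) (by omega)) (fun i hi => H_mem i (by omega))
  have h₃ := jetWedge_right (U := lev (n + 1)) (p := gₗ) (q := dₗ gₗ) (m := n + 4)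
    (fun i hi => G_mem i (by omega)) (fun i hi => G_mem (i + 1) (by omega))
  have h₄ := wedge_mem_sq (α_mem (n + 1)) (H_mem (m := n + 1) (n + 4) (by omega))
  convert Submodule.add_mem _ (Submodule.sub_mem _ (Submodule.add_mem _ (Submodule.neg_mem _ h₁)
    (Submodule.smul_mem _ (1 / 3 : ℝ) h₂)) (Submodule.smul_mem _ (1 / 2 : ℝ) h₃))
    (Submodule.smul_mem _ (2 : ℝ) h₄) using 1
  rw [d_H]
  refine TwoForm.ext fun X Y => ?_
  simp only [TwoForm.neg_apply, TwoForm.sub_apply, TwoForm.add_apply, TwoForm.smul_apply,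
    wedge_apply, jet_dₗ, jet_eq]
  ring

theorem d_K_mod (n : ℕ) : d₁ (K (n + 3)) - (K (n + 4) ⋏ F 0 - (1 / 2 : ℝ) • (G (n + 5) ⋏ H 0)
    - H (n + 5) ⋏ G 0) ∈ sq (lev (n + 1)) := by
  have h₁ := jetWedge_right (U := lev (n + 1)) (p := fₗ) (q := dₗ kₗ) (m := n + 3)
    (fun i hi => F_mem i (by omega)) (fun i hi => K_mem (i + 1) (by omega))
  have h₂ := jetWedge_mem (U := lev (n + 1)) (p := dₗ fₗ) (q := kₗ) (m := n + 3)
    (fun i hi => F_mem (i + 1) (by omega)) (fun i hi => K_mem i (by omega))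
  have h₃ := jetWedge_left (U := lev (n + 1)) (p := dₗ (dₗ gₗ)) (q := hₗ) (m := n + 3)
    (fun i hi => G_mem (i + 2) (by omega)) (fun i hi => H_mem i (by omega))
  have h₄ := jetWedge_mem (U := lev (n + 1)) (p := dₗ gₗ) (q := dₗ hₗ) (m := n + 3)
    (fun i hi => G_mem (i + 1) (by omega)) (fun i hi => H_mem (i + 1) (by omega))
  have h₅ := jetWedge_right (U := lev (n + 1)) (p := gₗ) (q := dₗ (dₗ hₗ)) (m := n + 3)
    (fun i hi => G_mem i (by omega)) (fun i hi => H_mem (i + 2) (by omega))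
  have h₆ := wedge_mem_sq (α_mem (n + 1)) (K_mem (m := n + 1) (n + 3) (by omega))
  convert Submodule.add_mem _ (Submodule.add_mem _ (Submodule.add_mem _ (Submodule.sub_mem _
    (Submodule.sub_mem _ (Submodule.neg_mem _ h₁) h₂) (Submodule.smul_mem _ (1 / 2 : ℝ) h₃))
    (Submodule.smul_mem _ (1 / 2 : ℝ) h₄)) h₅) (Submodule.smul_mem _ (3 : ℝ) h₆) using 1
  rw [d_K]
  refine TwoForm.ext fun X Y => ?_
  simp only [TwoForm.neg_apply, TwoForm.sub_apply, TwoForm.add_apply, TwoForm.smul_apply,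
    wedge_apply, jet_dₗ, jet_eq]
  ring

theorem d_L_mod (n : ℕ) : d₁ (L (n + 4)) - (L (n + 5) ⋏ F 0 - (1 / 3 : ℝ) • (F (n + 5) ⋏ L 0)
    + H (n + 5) ⋏ H 0 - K (n + 4) ⋏ G 0) ∈ sq (lev (n + 1)) := by
  have h₁ := jetWedge_right (U := lev (n + 1)) (p := fₗ) (q := dₗ lₗ) (m := n + 4)
    (fun i hi => F_mem i (by omega)) (fun i hi => L_mem (i + 1) (by omega))
  have h₂ := jetWedge_left (U := lev (n + 1)) (p := dₗ fₗ) (q := lₗ) (m := n + 4)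
    (fun i hi => F_mem (i + 1) (by omega)) (fun i hi => L_mem i (by omega))
  have h₃ := jetWedge_right (U := lev (n + 1)) (p := hₗ) (q := dₗ hₗ) (m := n + 4)
    (fun i hi => H_mem i (by omega)) (fun i hi => H_mem (i + 1) (by omega))
  have h₄ := jetWedge_right (U := lev (n + 1)) (p := gₗ) (q := kₗ) (m := n + 4)
    (fun i hi => G_mem i (by omega)) (fun i hi => K_mem i (by omega))
  have h₅ := wedge_mem_sq (α_mem (n + 1)) (L_mem (m := n + 1) (n + 4) (by omega))
  convert Submodule.add_mem _ (Submodule.add_mem _ (Submodule.sub_mem _ (Submodule.sub_mem _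
    (Submodule.neg_mem _ h₁) (Submodule.smul_mem _ (1 / 3 : ℝ) h₂)) h₃) h₄)
    (Submodule.smul_mem _ (4 : ℝ) h₅) using 1
  rw [d_L]
  refine TwoForm.ext fun X Y => ?_
  simp only [TwoForm.neg_apply, TwoForm.sub_apply, TwoForm.add_apply, TwoForm.smul_apply,
    wedge_apply, jet_dₗ, jet_eq]
  ring

/-- Below the new forms the differentials stay in the same level. -/
theorem d_H_mem {m k : ℕ} (hk : k < m + 3) : d₁ (H k) ∈ sq (lev m) := by
  have h₁ := jetWedge_mem (U := lev m) (p := fₗ) (q := dₗ hₗ) (m := k)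
    (fun i hi => F_mem i (by omega)) (fun i hi => H_mem (i + 1) (by omega))
  have h₂ := jetWedge_mem (U := lev m) (p := dₗ fₗ) (q := hₗ) (m := k)
    (fun i hi => F_mem (i + 1) (by omega)) (fun i hi => H_mem i (by omega))
  have h₃ := jetWedge_mem (U := lev m) (p := gₗ) (q := dₗ gₗ) (m := k)
    (fun i hi => G_mem i (by omega)) (fun i hi => G_mem (i + 1) (by omega))
  have h₄ := wedge_mem_sq (α_mem m) (H_mem (m := m) k (by omega))
  rw [d_H]
  exact Submodule.add_mem _ (Submodule.sub_mem _ (Submodule.add_mem _ (Submodule.neg_mem _ h₁)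
    (Submodule.smul_mem _ (1 / 3 : ℝ) h₂)) (Submodule.smul_mem _ (1 / 2 : ℝ) h₃))
    (Submodule.smul_mem _ (2 : ℝ) h₄)

end Levels

/-! The tableau. -/

/-- The coefficients with which `η₉, …, η₁₃` (and the forms of each later generation) enter the
structure equations of `η₄, …, η₈` (and those of the generation before). -/
def tableau (c e : Fin 5) (j : Fin 20) : ℝ :=
  (if j = 4 then (1 : Matrix (Fin 5) (Fin 5) ℝ) c e else 0)
  + (if j = 6 then !![0, 0, 0, 0, 0; 1, 0, 0, 0, 0; 0, 1, 0, 0, 0; 0, 0, 1, 0, 0; 0, 0, 0, 1, 0] c e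
      else 0)
  + (if j = 5 then !![0, 0, 0, 0, 0; 0, 0, 0, 0, 0; 1, 0, 0, 0, 0; 0, 1, 0, 0, 0; 0, 0, 1, 0, 0] c e
      else 0)
  + (if j = 0 then !![0, 0, 0, 0, 0; 0, 0, 0, 0, 0; 0, 0, 0, 0, 0; 0, 0, 0, 0, 0; -1, 0, 0, 0, 0] c e
      else 0)

/-- The tableau of the structure equations themselves. -/
def tableau₀ (i : Fin 20) (e : Fin 5) (j : Fin 20) : ℝ :=
  if h : 15 ≤ i.val then tableau ⟨i.val - 15, by omega⟩ e j else 0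

theorem tableau_sum (π : Fin 5 → Module.Dual ℝ G1) (c : Fin 5) :
    ∑ e, ∑ j, tableau c e j • (π e ⋏ baseForms j) =
      (![π 0 ⋏ ξ₁, π 0 ⋏ ξ₃ + π 1 ⋏ ξ₁, π 0 ⋏ ξ₂ + π 1 ⋏ ξ₃ + π 2 ⋏ ξ₁,
        π 1 ⋏ ξ₂ + π 2 ⋏ ξ₃ + π 3 ⋏ ξ₁, -(π 0 ⋏ θ₀) + π 2 ⋏ ξ₂ + π 3 ⋏ ξ₃ + π 4 ⋏ ξ₁] :
        Fin 5 → TwoForm G1) c := by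
  have h : ∀ e, ∑ j, tableau c e j • (π e ⋏ baseForms j) =
      (1 : Matrix (Fin 5) (Fin 5) ℝ) c e • (π e ⋏ ξ₁)
      + (!![0, 0, 0, 0, 0; 1, 0, 0, 0, 0; 0, 1, 0, 0, 0; 0, 0, 1, 0, 0; 0, 0, 0, 1, 0] :
          Matrix (Fin 5) (Fin 5) ℝ) c e • (π e ⋏ ξ₃)
      + (!![0, 0, 0, 0, 0; 0, 0, 0, 0, 0; 1, 0, 0, 0, 0; 0, 1, 0, 0, 0; 0, 0, 1, 0, 0] :
          Matrix (Fin 5) (Fin 5) ℝ) c e • (π e ⋏ ξ₂)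
      + (!![0, 0, 0, 0, 0; 0, 0, 0, 0, 0; 0, 0, 0, 0, 0; 0, 0, 0, 0, 0; -1, 0, 0, 0, 0] :
          Matrix (Fin 5) (Fin 5) ℝ) c e • (π e ⋏ θ₀) := by
    intro e
    simp only [tableau, add_smul, ite_smul, zero_smul, Finset.sum_add_distrib, Finset.sum_ite_eq',
      Finset.mem_univ, if_true]
    rfl
  simp only [h]
  fin_cases c <;> simp [Fin.sum_univ_five, Matrix.one_apply]

theorem tableau_comm (i e : Fin 5) (j k : Fin 20) :
    ∑ c, tableau i c j * tableau c e k = ∑ c, tableau i c k * tableau c e j := by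
  fin_cases i <;> fin_cases e <;>
    simp [tableau, Fin.sum_univ_five, Matrix.one_apply, -mul_ite, -ite_mul] <;> ring

theorem tableau_four (c e : Fin 5) : tableau c e 4 = if c = e then 1 else 0 := by
  simp [tableau, Matrix.one_apply]

/-- A tableau whose rows are those of `tableau` and zeros is prolonged by `tableau`. -/
theorem normalStep {μ : Type*} {A : μ → Fin 5 → Fin 20 → ℝ} (r : Fin 5 → μ)
    (hr : ∀ c, A (r c) = tableau c) (h0 : ∀ i, (∃ c, i = r c) ∨ A i = 0) (u : Fin 20 → G1)
    (hu : ∀ i j, baseForms i (u j) = if i = j then 1 else 0) :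
    NormalStep baseForms A tableau := by
  refine ⟨fun z => ⟨fun h => ?_, ?_⟩, fun v hv => ?_⟩
  · refine ⟨fun e => z e 4, fun c k => ?_⟩
    have h1 := h (r c)
    have h2 := congrArg (fun Θ : TwoForm G1 => Θ (u k) (u 4)) h1
    simp only [hr, TwoForm.sum_apply, TwoForm.smul_apply, wedge_apply, LinearMap.sum_apply,
      LinearMap.smul_apply, smul_eq_mul, hu, mul_ite, mul_one, mul_zero, Finset.sum_ite_eq',
      Finset.mem_univ, if_true, TwoForm.zero_apply, mul_sub, Finset.sum_sub_distrib,
      tableau_four, ite_mul, one_mul, zero_mul, Finset.sum_ite_eq] at h2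
    linarith
  · rintro ⟨v, hv⟩ i
    rcases h0 i with ⟨c, rfl⟩ | hi
    · refine TwoForm.ext fun X Y => ?_
      have hs : ∀ j k, ∑ a, tableau c a j * z a k = ∑ a, tableau c a k * z a j := by
        intro j k
        simp only [hv, Finset.mul_sum]
        rw [Finset.sum_comm]
        conv_rhs => rw [Finset.sum_comm]
        refine Finset.sum_congr rfl fun e _ => ?_
        have := congrArg (· * v e) (tableau_comm c e j k)
        simpa only [Finset.sum_mul, mul_assoc] using this
      have key : ∀ X Y : G1, ∑ a, ∑ j, tableau c a j * ((∑ k, z a k * baseForms k X) *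
          baseForms j Y) = ∑ j, ∑ k, (∑ a, tableau c a j * z a k) *
          (baseForms k X * baseForms j Y) := by
        intro X Y
        rw [Finset.sum_comm]
        refine Finset.sum_congr rfl fun j _ => ?_
        simp only [Finset.sum_mul, Finset.mul_sum]
        rw [Finset.sum_comm]
        exact Finset.sum_congr rfl fun k _ => Finset.sum_congr rfl fun a _ => by ring
      simp only [hr, TwoForm.sum_apply, TwoForm.smul_apply, wedge_apply, LinearMap.sum_apply,
        LinearMap.smul_apply, smul_eq_mul, TwoForm.zero_apply, mul_sub, Finset.sum_sub_distrib,
        key]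
      rw [sub_eq_zero, Finset.sum_comm]
      exact Finset.sum_congr rfl fun k _ => Finset.sum_congr rfl fun j _ => by
        rw [hs j k, mul_comm (baseForms k X)]
    · simp [hi]
  · funext c
    have := hv c 4
    simpa [tableau_four] using this

/-! The forms are the coordinates of a basis. -/

theorem exists_basis {J V : Type*} [AddCommGroup V] [Module ℝ V] (φ : J → Module.Dual ℝ V)
    (hfin : ∀ x, {j | φ j x ≠ 0}.Finite) (hinj : ∀ x, (∀ j, φ j x = 0) → x = 0)
    (hsurj : ∀ c : J →₀ ℝ, ∃ x, ∀ j, φ j x = c j) :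
    ∃ b : Module.Basis J ℝ V, ∀ j, b.coord j = φ j := by
  let T : V →ₗ[ℝ] J →₀ ℝ :=
    { toFun := fun x => Finsupp.ofSupportFinite (fun j => φ j x) (hfin x)
      map_add' := fun x y => by ext j; exact map_add (φ j) x y
      map_smul' := fun c x => by ext j; exact map_smul (φ j) c x }
  have hT : ∀ x j, T x j = φ j x := fun x j => rfl
  have hb : Function.Bijective T := by
    constructor
    · rw [← LinearMap.ker_eq_bot, LinearMap.ker_eq_bot']
      exact fun x hx => hinj x fun j => by rw [← hT, hx]; rfl
    · intro c
      obtain ⟨x, hx⟩ := hsurj c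
      exact ⟨x, by ext j; rw [hT, hx]⟩
  exact ⟨.ofRepr (LinearEquiv.ofBijective T hb), fun j => by ext x; rfl⟩

theorem eval_iterate (p : ℝ[X]) (m : ℕ) :
    (derivative^[m] p).eval 0 = (m.factorial : ℝ) * p.coeff m := by
  rw [← coeff_zero_eq_eval_zero, coeff_iterate_derivative, zero_add, Nat.descFactorial_self,
    nsmul_eq_mul]

/-- The polynomial with given derivatives at zero. -/
theorem exists_poly (v : ℕ → ℝ) (N : ℕ) (hN : ∀ m, N ≤ m → v m = 0) :
    ∃ p : ℝ[X], ∀ m, (derivative^[m] p).eval 0 = v m := by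
  refine ⟨∑ i ∈ Finset.range N, monomial i (v i / (i.factorial : ℝ)), fun m => ?_⟩
  rw [eval_iterate, finsetSum_coeff]
  simp only [coeff_monomial, Finset.sum_ite_eq', Finset.mem_range]
  have := Nat.factorial_ne_zero m
  split_ifs with h
  · field_simp
  · rw [mul_zero, hN m (by omega)]

theorem eq_zero_of_jets {p : ℝ[X]} (h : ∀ m, (derivative^[m] p).eval 0 = 0) : p = 0 := by
  ext m
  have := h m
  rw [eval_iterate] at this
  simpa [Nat.factorial_ne_zero] using this

theorem jet_eventually (p : ℝ[X]) (m : ℕ) (h : p.natDegree < m) :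
    (derivative^[m] p).eval 0 = 0 := by
  rw [iterate_derivative_eq_zero h, eval_zero]

/-- All the forms together. -/
def allForms : Fin 20 ⊕ ℕ × Fin 5 → Module.Dual ℝ G1 :=
  Sum.elim baseForms fun p => newForms p.1 p.2

theorem allForms_basis : ∃ b : Module.Basis (Fin 20 ⊕ ℕ × Fin 5) ℝ G1,
    ∀ j, b.coord j = allForms j := by
  refine exists_basis _ (fun x => ?_) (fun x hx => ?_) (fun c => ?_)
  · obtain ⟨N, hN⟩ : ∃ N, ∀ n, N ≤ n → ∀ e, newForms n e x = 0 := by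
      refine ⟨x.f.natDegree + x.g.natDegree + x.h.natDegree + x.k.natDegree + x.l.natDegree + 1,
        fun n hn e => ?_⟩
      have hF : F (n + 4) x = 0 := jet_eventually x.f _ (by omega)
      have hG : G (n + 4) x = 0 := jet_eventually x.g _ (by omega)
      have hH : H (n + 4) x = 0 := jet_eventually x.h _ (by omega)
      have hH' : H (n + 2) x = 0 := jet_eventually x.h _ (by omega)
      have hK : K (n + 3) x = 0 := jet_eventually x.k _ (by omega)
      have hL : L (n + 4) x = 0 := jet_eventually x.l _ (by omega)
      fin_cases e <;> simp [newForms, hF, hG, hH, hH', hK, hL]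
    refine ((Set.finite_range (Sum.inl : Fin 20 → Fin 20 ⊕ ℕ × Fin 5)).union
      (((Set.finite_Iio N).prod (Set.finite_univ (α := Fin 5))).image Sum.inr)).subset ?_
    rintro (i | ⟨n, e⟩) h
    · exact Or.inl ⟨i, rfl⟩
    · refine Or.inr ⟨(n, e), ⟨?_, Set.mem_univ _⟩, rfl⟩
      by_contra hn
      exact h (hN n (not_lt.1 hn) e)
  · have hlev : ∀ m, ∀ φ ∈ lev m, φ x = 0 := by
      intro m φ hφ
      have : lev m ≤ LinearMap.ker (Module.Dual.eval ℝ G1 x) := by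
        rw [lev, level, Submodule.span_le]
        rintro _ (⟨i, rfl⟩ | ⟨k, _, e, rfl⟩)
        · exact hx (Sum.inl i)
        · exact hx (Sum.inr (k, e))
      exact this hφ
    ext1
    · exact hlev 0 _ (α_mem 0)
    · exact eq_zero_of_jets fun m => hlev (m + 1) _ (F_mem m (by omega))
    · exact eq_zero_of_jets fun m => hlev (m + 1) _ (G_mem m (by omega))
    · exact eq_zero_of_jets fun m => hlev (m + 1) _ (H_mem m (by omega))
    · exact eq_zero_of_jets fun m => hlev (m + 1) _ (K_mem m (by omega))
    · exact eq_zero_of_jets fun m => hlev (m + 1) _ (L_mem m (by omega))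
  · obtain ⟨N, hN⟩ : ∃ N, ∀ n, N ≤ n → ∀ e : Fin 5, c (Sum.inr (n, e)) = 0 := by
      refine ⟨c.support.sup (Sum.elim (fun _ => 0) fun p => p.1) + 1, fun n hn e => ?_⟩
      by_contra h
      have := Finset.le_sup (f := Sum.elim (fun _ => 0) fun p : ℕ × Fin 5 => p.1)
        (Finsupp.mem_support_iff.2 h)
      simp only [Sum.elim_inr] at this
      omega
    let B : Fin 20 → ℝ := fun i => c (Sum.inl i)
    let P : ℕ → Fin 5 → ℝ := fun n e => c (Sum.inr (n, e))
    have hP : ∀ n, N ≤ n → ∀ e, P n e = 0 := hN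
    let vH : ℕ → ℝ := fun m => match m with
      | 0 => B 5 | 1 => -B 2 | 2 => B 8 | 3 => B 17 | n + 4 => P n 2
    let vF : ℕ → ℝ := fun m => match m with
      | 0 => B 4 | 1 => B 13 | 2 => 3 * (B 10 + B 5) | 3 => 3 * (B 15 - B 2)
      | n + 4 => 3 * (P n 0 + vH (n + 2))
    let vG : ℕ → ℝ := fun m => match m with
      | 0 => B 6 | 1 => 2 * B 14 | 2 => 2 * B 11 | 3 => 2 * B 16 | n + 4 => 2 * P n 1
    let vK : ℕ → ℝ := fun m => match m with
      | 0 => B 3 | 1 => -B 9 | 2 => -B 18 | n + 3 => -P n 3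
    let vL : ℕ → ℝ := fun m => match m with
      | 0 => B 0 | 1 => -B 1 | 2 => B 7 | 3 => B 19 | n + 4 => P n 4
    have hvH : ∀ m, N + 4 ≤ m → vH m = 0 := by
      intro m hm
      obtain ⟨n, rfl⟩ : ∃ n, m = n + 4 := ⟨m - 4, by omega⟩
      exact hP n (by omega) 2
    have hvF : ∀ m, N + 6 ≤ m → vF m = 0 := by
      intro m hm
      obtain ⟨n, rfl⟩ : ∃ n, m = n + 4 := ⟨m - 4, by omega⟩
      change 3 * (P n 0 + vH (n + 2)) = 0
      rw [hP n (by omega) 0, hvH _ (by omega)]; ring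
    have hvG : ∀ m, N + 4 ≤ m → vG m = 0 := by
      intro m hm
      obtain ⟨n, rfl⟩ : ∃ n, m = n + 4 := ⟨m - 4, by omega⟩
      change 2 * P n 1 = 0
      rw [hP n (by omega) 1]; ring
    have hvK : ∀ m, N + 4 ≤ m → vK m = 0 := by
      intro m hm
      obtain ⟨n, rfl⟩ : ∃ n, m = n + 3 := ⟨m - 3, by omega⟩
      change -P n 3 = 0
      rw [hP n (by omega) 3]; ring
    have hvL : ∀ m, N + 4 ≤ m → vL m = 0 := by
      intro m hm
      obtain ⟨n, rfl⟩ : ∃ n, m = n + 4 := ⟨m - 4, by omega⟩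
      exact hP n (by omega) 4
    obtain ⟨pF, hF⟩ := exists_poly vF _ hvF
    obtain ⟨pG, hG⟩ := exists_poly vG _ hvG
    obtain ⟨pH, hH⟩ := exists_poly vH _ hvH
    obtain ⟨pK, hK⟩ := exists_poly vK _ hvK
    obtain ⟨pL, hL⟩ := exists_poly vL _ hvL
    let x : G1 := ⟨(B 12 + B 13 / 3) / 4, pF, pG, pH, pK, pL⟩
    have ha : α x = (B 12 + B 13 / 3) / 4 := rfl
    replace hF : ∀ m, F m x = vF m := hF
    replace hG : ∀ m, G m x = vG m := hG
    replace hH : ∀ m, H m x = vH m := hH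
    replace hK : ∀ m, K m x = vK m := hK
    replace hL : ∀ m, L m x = vL m := hL
    refine ⟨x, ?_⟩
    rintro (i | ⟨n, e⟩)
    · change baseForms i x = B i
      fin_cases i <;>
        simp [baseForms, θ₀, θ₁, θ₂, θ₃, ξ₁, ξ₂, ξ₃, σ₁₁, σ₁₂, σ₁₃, σ₂₂, σ₂₃, η₁, η₂, η₃, η₄, η₅,
          η₆, η₇, η₈, ha, hF, hG, hH, hK, hL, vF, vG, vH, vK, vL]
      all_goals ring
    · change newForms n e x = P n e
      fin_cases e <;> simp [newForms, hF, hG, hH, hK, hL, vF, vG, vH, vK, vL]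

theorem newForms_principal (n : ℕ) (c : Fin 5) :
    d₁ (newForms n c) - ∑ e, ∑ j, tableau c e j • (newForms (n + 1) e ⋏ baseForms j)
      ∈ sq (lev (n + 1)) := by
  rw [tableau_sum]
  have hF := d_F_mod n
  have hG := d_G_mod n
  have hH := d_H_mod n
  have hK := d_K_mod n
  have hL := d_L_mod n
  have h2 := d_H_mem (m := n + 1) (k := n + 2) (by omega)
  have w : ∀ {p : Module.Dual ℝ G1}, p ∈ lev (n + 1) → H (n + 3) ⋏ p ∈ sq (lev (n + 1)) :=
    fun hp => wedge_mem_sq (H_mem _ (by omega)) hp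
  have w1 := w (F_mem 0 (by omega))
  have w2 := w (G_mem 0 (by omega))
  have w3 := w (H_mem 0 (by omega))
  have w4 := w (L_mem 0 (by omega))
  fin_cases c
  · convert Submodule.add_mem _ (Submodule.sub_mem _ (Submodule.smul_mem _ (1 / 3 : ℝ) hF) h2) w1
      using 1
    simp only [newForms, map_sub, map_smul]
    refine TwoForm.ext fun X Y => ?_
    simp [wedge_apply, ξ₁]
    ring
  · convert Submodule.add_mem _ (Submodule.smul_mem _ (1 / 2 : ℝ) hG) w2 using 1
    simp only [newForms, map_sub, map_smul]
    refine TwoForm.ext fun X Y => ?_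
    simp [wedge_apply, ξ₁, ξ₃]
    ring
  · convert Submodule.add_mem _ hH w3 using 1
    simp only [newForms, map_sub, map_smul]
    refine TwoForm.ext fun X Y => ?_
    simp [wedge_apply, ξ₁, ξ₂, ξ₃]
    ring
  · convert Submodule.neg_mem _ hK using 1
    simp only [newForms, map_sub, map_smul]
    refine TwoForm.ext fun X Y => ?_
    simp [wedge_apply, ξ₁, ξ₂, ξ₃]
    ring
  · convert Submodule.sub_mem _ hL w4 using 1
    simp only [newForms, map_sub, map_smul]
    refine TwoForm.ext fun X Y => ?_
    simp [wedge_apply, ξ₁, ξ₂, ξ₃, θ₀]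
    ring

set_option maxHeartbeats 1000000 in
theorem baseForms_principal (i : Fin 20) :
    d₁ (baseForms i) - ∑ c, ∑ j, tableau₀ i c j • (newForms 0 c ⋏ baseForms j)
      ∈ sq (lev 0) := by
  obtain ⟨e0, e1, e2, e3, e4, e5, e6, e7, e8, e9, e10, e11, e12, e13, e14, e15, e16, e17, e18,
    e19⟩ := structureEquations
  have b : ∀ i, baseForms i ∈ lev 0 := base_mem 0
  have m0 : θ₀ ∈ lev 0 := b 0
  have m1 : θ₁ ∈ lev 0 := b 1
  have m2 : θ₂ ∈ lev 0 := b 2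
  have m3 : θ₃ ∈ lev 0 := b 3
  have m4 : ξ₁ ∈ lev 0 := b 4
  have m5 : ξ₂ ∈ lev 0 := b 5
  have m6 : ξ₃ ∈ lev 0 := b 6
  have m7 : σ₁₁ ∈ lev 0 := b 7
  have m8 : σ₁₂ ∈ lev 0 := b 8
  have m9 : σ₁₃ ∈ lev 0 := b 9
  have m10 : σ₂₂ ∈ lev 0 := b 10
  have m11 : σ₂₃ ∈ lev 0 := b 11
  have m12 : η₁ ∈ lev 0 := b 12
  have m13 : η₂ ∈ lev 0 := b 13
  have m14 : η₃ ∈ lev 0 := b 14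
  have m15 : η₄ ∈ lev 0 := b 15
  have m16 : η₅ ∈ lev 0 := b 16
  have m17 : η₆ ∈ lev 0 := b 17
  have m18 : η₇ ∈ lev 0 := b 18
  have m19 : η₈ ∈ lev 0 := b 19
  have hz : ∀ i : Fin 20, i.val < 15 →
      ∑ c, ∑ j, tableau₀ i c j • (newForms 0 c ⋏ baseForms j) = 0 := by
    intro i hi
    simp [tableau₀, show ¬ 15 ≤ i.val by omega]
  have hp : ∀ (i : Fin 20) (h : 15 ≤ i.val),
      ∑ c, ∑ j, tableau₀ i c j • (newForms 0 c ⋏ baseForms j) =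
      ∑ c, ∑ j, tableau ⟨i.val - 15, by omega⟩ c j • (newForms 0 c ⋏ baseForms j) := by
    intro i hi
    simp [tableau₀, hi]
  by_cases hi : i.val < 15
  · rw [hz i hi, sub_zero]
    have key : ∀ i : Fin 15, d₁ (baseForms (Fin.castLE (by norm_num) i)) ∈ sq (lev 0) := by
      intro i
      fin_cases i
      change d₁ θ₀ ∈ _; rw [e0]; rotate_left
      change d₁ θ₁ ∈ _; rw [e1]; rotate_left
      change d₁ θ₂ ∈ _; rw [e2]; rotate_left
      change d₁ θ₃ ∈ _; rw [e3]; rotate_left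
      change d₁ ξ₁ ∈ _; rw [e4]; rotate_left
      change d₁ ξ₂ ∈ _; rw [e5]; rotate_left
      change d₁ ξ₃ ∈ _; rw [e6]; rotate_left
      change d₁ σ₁₁ ∈ _; rw [e7]; rotate_left
      change d₁ σ₁₂ ∈ _; rw [e8]; rotate_left
      change d₁ σ₁₃ ∈ _; rw [e9]; rotate_left
      change d₁ σ₂₂ ∈ _; rw [e10]; rotate_left
      change d₁ σ₂₃ ∈ _; rw [e11]; rotate_left
      change d₁ η₁ ∈ _; rw [e12]; rotate_left
      change d₁ η₂ ∈ _; rw [e13]; rotate_left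
      change d₁ η₃ ∈ _; rw [e14]; rotate_left
      all_goals
        with_reducible
          repeat' first
            | assumption
            | apply wedge_mem_sq
            | apply Submodule.add_mem
            | apply Submodule.sub_mem
            | apply Submodule.smul_mem
    exact key ⟨i, hi⟩
  · rw [hp i (by omega), tableau_sum]
    have key : ∀ (k : ℕ) (hk : k < 5), d₁ (baseForms ⟨k + 15, by omega⟩) -
        (![newForms 0 0 ⋏ ξ₁, newForms 0 0 ⋏ ξ₃ + newForms 0 1 ⋏ ξ₁,
          newForms 0 0 ⋏ ξ₂ + newForms 0 1 ⋏ ξ₃ + newForms 0 2 ⋏ ξ₁,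
          newForms 0 1 ⋏ ξ₂ + newForms 0 2 ⋏ ξ₃ + newForms 0 3 ⋏ ξ₁,
          -(newForms 0 0 ⋏ θ₀) + newForms 0 2 ⋏ ξ₂ + newForms 0 3 ⋏ ξ₃ + newForms 0 4 ⋏ ξ₁] :
          Fin 5 → TwoForm G1) ⟨k, hk⟩ ∈ sq (lev 0) := by
      intro k hk
      interval_cases k
      change d₁ η₄ - (η₉ ⋏ ξ₁) ∈ _
      have h : d₁ η₄ - (η₉ ⋏ ξ₁) =
          (1 / 2 : ℝ) • (η₂ ⋏ ((3 : ℝ) • θ₂ - (4 : ℝ) • η₄) + η₁ ⋏ θ₂) + ξ₂ ⋏ σ₂₂ + ξ₃ ⋏ σ₂₃ := by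
        rw [e15]; abel
      rw [h]; clear h; rotate_left
      change d₁ η₅ - (η₉ ⋏ ξ₃ + η₁₀ ⋏ ξ₁) ∈ _
      have h : d₁ η₅ - (η₉ ⋏ ξ₃ + η₁₀ ⋏ ξ₁) =
          (1 / 4 : ℝ) • ((η₁ - (9 : ℝ) • η₂) ⋏ η₅) - (3 : ℝ) • (η₃ ⋏ (η₄ - θ₂)) + σ₁₂ ⋏ ξ₃ + (3 :
          ℝ) • (σ₂₃ ⋏ (ξ₂ + σ₂₂)) := by
        rw [e16]; abel
      rw [h]; clear h; rotate_left
      change d₁ η₆ - (η₉ ⋏ ξ₂ + η₁₀ ⋏ ξ₃ + η₁₁ ⋏ ξ₁) ∈ _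
      have h : d₁ η₆ - (η₉ ⋏ ξ₂ + η₁₀ ⋏ ξ₃ + η₁₁ ⋏ ξ₁) =
          (1 / 2 : ℝ) • ((η₁ - (5 : ℝ) • η₂) ⋏ η₆) - (4 : ℝ) • (η₃ ⋏ η₅) + σ₁₂ ⋏ ((7 : ℝ) • ξ₂ +
          (6 : ℝ) • σ₂₂) := by
        rw [e17]; abel
      rw [h]; clear h; rotate_left
      change d₁ η₇ - (η₁₀ ⋏ ξ₂ + η₁₁ ⋏ ξ₃ + η₁₂ ⋏ ξ₁) ∈ _
      have h : d₁ η₇ - (η₁₀ ⋏ ξ₂ + η₁₁ ⋏ ξ₃ + η₁₂ ⋏ ξ₁) =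
          (1 / 4 : ℝ) • (((3 : ℝ) • η₁ - (11 : ℝ) • η₂) ⋏ η₇) - (5 : ℝ) • (η₃ ⋏ η₆) + (3 : ℝ) •
          (η₄ ⋏ θ₃) - (η₅ - (3 : ℝ) • θ₃) ⋏ θ₂ + (3 : ℝ) • (σ₁₂ ⋏ σ₂₃) + (9 : ℝ) • (σ₁₃ ⋏ (ξ₂ +
          σ₂₂)) := by
        rw [e18]; abel
      rw [h]; clear h; rotate_left
      change d₁ η₈ - (-(η₉ ⋏ θ₀) + η₁₁ ⋏ ξ₂ + η₁₂ ⋏ ξ₃ + η₁₃ ⋏ ξ₁) ∈ _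
      have h : d₁ η₈ - (-(η₉ ⋏ θ₀) + η₁₁ ⋏ ξ₂ + η₁₂ ⋏ ξ₃ + η₁₃ ⋏ ξ₁) =
          (η₁ - (3 : ℝ) • η₂) ⋏ η₈ + (6 : ℝ) • (η₄ ⋏ θ₁ - η₃ ⋏ η₇ + σ₁₃ ⋏ σ₂₃) + (2 : ℝ) • (η₅ ⋏
          θ₃) - (2 : ℝ) • ((η₆ - (3 : ℝ) • θ₁) ⋏ θ₂) - σ₁₂ ⋏ θ₀ + (12 : ℝ) • (σ₁₁ ⋏ (ξ₂ + σ₂₂)) := by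
        rw [e19, map_add, LinearMap.add_apply]; abel
      rw [h]; clear h; rotate_left
      all_goals
        with_reducible
          repeat' first
            | assumption
            | apply wedge_mem_sq
            | apply Submodule.add_mem
            | apply Submodule.sub_mem
            | apply Submodule.smul_mem
    have := key (i.val - 15) (by omega)
    simpa [show i.val - 15 + 15 = i.val by omega] using this

/-- `𝔤₁` is the normal prolongation of the structure equations. -/
theorem isNormalProlongation : IsNormalProlongation baseForms newForms := by
  obtain ⟨b, hb⟩ := allForms_basis
  have hu : ∀ i j, baseForms i (b (Sum.inl j)) = if i = j then 1 else 0 := by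
    intro i j
    have := congrArg (fun φ => φ (b (Sum.inl j))) (hb (Sum.inl i))
    simp only [Module.Basis.coord_apply, Module.Basis.repr_self, Finsupp.single_apply,
      Sum.inl.injEq] at this
    rw [show baseForms i = allForms (Sum.inl i) from rfl, ← this]
    simp [eq_comm]
  refine ⟨⟨b, fun i => hb _, fun n c => hb _⟩, tableau₀, fun _ => tableau, baseForms_principal,
    newForms_principal, normalStep (fun c => ⟨c.val + 15, by omega⟩) (fun c => ?_) (fun i => ?_) _ hu,
    fun _ => normalStep id (fun c => rfl) (fun i => Or.inl ⟨i, rfl⟩) _ hu⟩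
  · funext e j
    simp [tableau₀]
  · by_cases hi : 15 ≤ i.val
    · exact Or.inl ⟨⟨i.val - 15, by omega⟩, Fin.ext (by simp; omega)⟩
    · right
      funext e j
      simp [tableau₀, hi]

/-! ## The forms of the theorem -/

/-- The closed 1-form `ζ = 3 η₁ + η₂`. -/
def ζ : Module.Dual ℝ G1 := (3 : ℝ) • η₁ + η₂

/-- The 2-form `Ω`. -/
def Ω : TwoForm G1 :=
  (1 / 4 : ℝ) • ((η₁ - η₂ - (4 : ℝ) • η₃) ⋏ (ξ₁ + ξ₂ + ξ₃)) + θ₂ ⋏ (ξ₁ + ξ₃) + θ₃ ⋏ ξ₁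

end PKhZ

end

noncomputable section

open Polynomial

/-! ### Evaluation of 2-forms and elementwise closedness conditions -/

namespace LieForms

variable {L : Type*} [LieRing L] [LieAlgebra ℝ L]

/-! The structure equations and the normal prolongation are already available as
`structureEquations` and `isNormalProlongation`; what remains is the cohomology. It is computed by
weights. The Euler vector `vD` (`f = t`) acts diagonally on the monomial basis `vec` (`lie_vD_vec`),
and only `vE` and `vD` itself have weight zero. Moreover `ζ = 12 α`, so `λζ = s α` with `s = 12 λ`,
and `α` vanishes on `vD` and on all brackets. Hence `vD` acts on the deformed complex by the plain
Lie derivative, and the usual homotopy argument (contraction with `vD`) makes all nonzero weights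
acyclic.

For 2-forms this means: after subtracting a coboundary (`exists_reduction`) a cocycle is nonzero
only on pairs of opposite weights (`apply_vec_eq_zero`). Negative weights occur only at `f = 1`, `g
= 1`, `h = 1`, so few pairs survive. One value is normalised away, and four instances of the cocycle
identity express the others through the single number `Θ(K0, F0)`, where `K0` is the vector `k = 1`
and `F0` the vector `f = 1` (`eq_zero_of_cocycle`). Coboundaries vanish on this pair, so evaluation
there embeds the whole of `H²` into `ℝ` (`mem_B2_of_apply_K0_F0`, `coboundary_K0_F0`).

Finally `vE` scales `K0` by `-3` and commutes with `F0`; the cocycle identity on `vE, K0, F0`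
becomes `(s + 3) Θ(K0, F0) = 0` (`apply_K0_F0_eq_zero`). So `H²` vanishes unless `s = -3`, that is
`λ = -1/4`, and there `Ω`, with `Ω(K0, F0) = 1`, spans it. The ideal plays no role in the upper
bound: it is needed only to see that `Ω` belongs to it. -/

theorem TwoForm.map_smul_left (Θ : TwoForm L) (c : ℝ) (X Y : L) : Θ (c • X) Y = c * Θ X Y :=
  LinearMap.map_smul₂ Θ.1 c X Y

theorem TwoForm.map_zero_left (Θ : TwoForm L) (Y : L) : Θ 0 Y = 0 :=
  LinearMap.map_zero₂ Θ.1 Y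

theorem TwoForm.self (Θ : TwoForm L) (X : L) : Θ X X = 0 := Θ.2 X

theorem TwoForm.swap (Θ : TwoForm L) (X Y : L) : Θ X Y = -Θ Y X := by
  have h : Θ.1 (X + Y) (X + Y) = 0 := Θ.2 _
  have hX : Θ.1 X X = 0 := Θ.2 _
  have hY : Θ.1 Y Y = 0 := Θ.2 _
  simp only [map_add, LinearMap.add_apply, hX, hY] at h
  change Θ.1 X Y = -Θ.1 Y X
  linarith

/-- Contraction of a 2-form with a vector. -/
def TwoForm.contract (Θ : TwoForm L) (X : L) : Module.Dual ℝ L := Θ.1 X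

theorem TwoForm.contract_apply (Θ : TwoForm L) (X Y : L) : Θ.contract X Y = Θ X Y := rfl

theorem TwoForm.ext_span {S : Set L} (hS : Submodule.span ℝ S = ⊤) {Θ Ψ : TwoForm L}
    (h : ∀ X ∈ S, ∀ Y ∈ S, Θ X Y = Ψ X Y) : Θ = Ψ :=
  Subtype.ext <| LinearMap.ext_on hS fun X hX => LinearMap.ext_on hS fun Y hY => h X hX Y hY

theorem mem_H1_iff {θ : Module.Dual ℝ L} : θ ∈ H1 L ↔ ∀ X Y : L, θ ⁅X, Y⁆ = 0 := by
  refine ⟨fun h X Y => ?_, fun h => TwoForm.ext fun X Y => by simp [d₁_apply, h]⟩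
  have h' : d₁ θ X Y = 0 := by rw [show d₁ θ = 0 from h]; rfl
  simpa [d₁_apply] using h'

theorem mem_Z2_iff {ω : Module.Dual ℝ L} {Θ : TwoForm L} : Θ ∈ Z2 ω ↔ ∀ X Y Z : L,
    -Θ ⁅X, Y⁆ Z + Θ ⁅X, Z⁆ Y - Θ ⁅Y, Z⁆ X + (ω X * Θ Y Z - ω Y * Θ X Z + ω Z * Θ X Y) = 0 :=
  ⟨fun h X Y Z => congrFun (congrFun (congrFun h X) Y) Z,
    fun h => funext fun X => funext fun Y => funext fun Z => h X Y Z⟩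

theorem dDef₁_apply (ω θ : Module.Dual ℝ L) (X Y : L) :
    dDef₁ ω θ X Y = -θ ⁅X, Y⁆ + (ω X * θ Y - ω Y * θ X) := rfl

theorem dDef₁_mem_B2 (ω θ : Module.Dual ℝ L) : dDef₁ ω θ ∈ B2 ω := ⟨θ, rfl⟩

end LieForms

namespace PKhZ

open LieForms G1

/-! ### Monomial vectors and their weights -/

/-- The vector of the scaling parameter. -/
def vE : G1 := ⟨1, 0, 0, 0, 0, 0⟩

/-- The vector with the polynomial `p` in the place `i` among `f, g, h, k, l`. -/
def place (i : Fin 5) : ℝ[X] →ₗ[ℝ] G1 where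
  toFun p := match i with
    | 0 => ⟨0, p, 0, 0, 0, 0⟩
    | 1 => ⟨0, 0, p, 0, 0, 0⟩
    | 2 => ⟨0, 0, 0, p, 0, 0⟩
    | 3 => ⟨0, 0, 0, 0, p, 0⟩
    | 4 => ⟨0, 0, 0, 0, 0, p⟩
  map_add' p q := by fin_cases i <;> ext1 <;> simp
  map_smul' c p := by fin_cases i <;> ext1 <;> simp

/-- The basis of `𝔤₁` formed by `vE` and the monomials `tⁿ` in each place. -/
def vec : Option (Fin 5 × ℕ) → G1
  | none => vE
  | some (i, n) => place i (X ^ n)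

/-- Three times the eigenvalue of `vec p` under the bracket with `f = t`. -/
def weight : Option (Fin 5 × ℕ) → ℤ
  | none => 0
  | some (i, n) => 3 * n + ![-3, -2, -1, 3, 1] i

/-- The Euler vector `f = t`. -/
abbrev vD : G1 := vec (some (0, 1))

theorem span_vec : Submodule.span ℝ (Set.range vec) = ⊤ := by
  rw [eq_top_iff]
  rintro ⟨a, f, g, h, k, l⟩ -
  have hp : ∀ i p, place i p ∈ Submodule.span ℝ (Set.range vec) := by
    intro i p
    induction p using Polynomial.induction_on' with
    | add p q hp hq => rw [map_add]; exact Submodule.add_mem _ hp hq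
    | monomial n c =>
      rw [← smul_X_eq_monomial, map_smul]
      exact Submodule.smul_mem _ _ (Submodule.subset_span ⟨some (i, n), rfl⟩)
  have h0 : (⟨a, f, g, h, k, l⟩ : G1) =
      a • vE + place 0 f + place 1 g + place 2 h + place 3 k + place 4 l := by
    ext1 <;> simp [vE, place]
  rw [h0]
  exact Submodule.add_mem _ (Submodule.add_mem _ (Submodule.add_mem _ (Submodule.add_mem _
    (Submodule.add_mem _ (Submodule.smul_mem _ _ (Submodule.subset_span ⟨none, rfl⟩))
    (hp _ _)) (hp _ _)) (hp _ _)) (hp _ _)) (hp _ _)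

theorem X_mul_derivative_X_pow (n : ℕ) : (X : ℝ[X]) * derivative (X ^ n) = C (n : ℝ) * X ^ n := by
  rcases n with _ | n
  · simp
  · rw [derivative_X_pow, Nat.add_sub_cancel]
    ring

/-- Bracketing with `f = t` is `t d/dt` plus a constant that depends only on the place: `-1, -2/3,
-1/3, 1, 1/3` for `f, g, h, k, l`. These constants, tripled to stay in `ℤ`, are the offsets in
`weight`. -/
theorem lie_vD_vec (p : Option (Fin 5 × ℕ)) : ⁅vD, vec p⁆ = (weight p / 3 : ℝ) • vec p := by
  rcases p with _ | ⟨i, n⟩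
  · ext1 <;> simp [vec, vE, place, weight, lie_f, lie_g, lie_h, lie_k, lie_l]
  · have h := X_mul_derivative_X_pow n
    have h₁ : (3 * (n : ℝ) + -3) / 3 = n - 1 := by ring
    have h₂ : (3 * (n : ℝ) + -2) / 3 = n - 2 / 3 := by ring
    have h₃ : (3 * (n : ℝ) + -1) / 3 = n - 3⁻¹ := by ring
    have h₄ : (3 * (n : ℝ) + 3) / 3 = n + 1 := by ring
    have h₅ : (3 * (n : ℝ) + 1) / 3 = n + 3⁻¹ := by ring
    fin_cases i <;> ext1 <;>
      simp [vec, place, weight, lie_f, lie_g, lie_h, lie_k, lie_l, h, smul_eq_C_mul, h₁, h₂, h₃,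
        h₄, h₅, add_mul, sub_mul]

theorem α_vec_some (i : Fin 5) (n : ℕ) : α (vec (some (i, n))) = 0 := by
  fin_cases i <;> rfl

theorem α_vE : α vE = 1 := rfl

theorem α_lie (X Y : G1) : α ⁅X, Y⁆ = 0 := rfl

/-- The monomials form a basis of `ℝ[X]`, so the values of a 1-form on the vectors `vec p` can be
prescribed freely, with no finiteness condition. This supplies the primitives in `exists_reduction`.
-/
theorem exists_dual (c : Option (Fin 5 × ℕ) → ℝ) :
    ∃ β : Module.Dual ℝ G1, ∀ p, β (vec p) = c p := by
  refine ⟨c none • α + ∑ i : Fin 5, (lsum fun n => c (some (i, n)) • LinearMap.id) ∘ₗ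
    (![fₗ, gₗ, hₗ, kₗ, lₗ] i), ?_⟩
  rintro (_ | ⟨i, n⟩)
  · simp [vec, vE, α, Fin.sum_univ_five, fₗ, gₗ, hₗ, kₗ, lₗ]
  · have h : ∀ i, lsum (fun n => c (some (i, n)) • (LinearMap.id : ℝ →ₗ[ℝ] ℝ)) (X ^ n) =
        c (some (i, n)) := by
      intro i
      rw [lsum_apply, ← monomial_one_right_eq_X_pow, sum_monomial_index] <;> simp
    fin_cases i <;>
      simp [vec, place, α, Fin.sum_univ_five, fₗ, gₗ, hₗ, kₗ, lₗ, -lsum_apply, h]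

/-- Modulo 3 the weights in the places `g`, `h`, `l` are nonzero, and in the place `k` they are at
least 3; in the place `f` only `n = 1` gives zero. -/
theorem weight_eq_zero {p : Option (Fin 5 × ℕ)} (h : weight p = 0) :
    p = none ∨ p = some (0, 1) := by
  rcases p with _ | ⟨i, n⟩
  · exact Or.inl rfl
  · right
    fin_cases i <;> simp [weight] at h ⊢ <;> omega

/-! ### Brackets of monomial vectors -/

section Brackets

local notation "e" => fun (i : Fin 5) (n : ℕ) => vec (some (i, n))

/-- In the names of these lemmas a letter with a number is a vector: `F2` is `f = t²`, `H1` is `h =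
t`, `K0` is `k = 1`. These are the brackets entering the instances of the cocycle identity used
below. -/
theorem lie_vE_K0 : ⁅vE, e 3 0⁆ = (-3 : ℝ) • e 3 0 := by
  ext1 <;> simp [vec, vE, place, lie_f, lie_g, lie_h, lie_k, lie_l, smul_eq_C_mul]
theorem lie_vE_F (n : ℕ) : ⁅vE, e 0 n⁆ = 0 := by
  ext1 <;> simp [vec, vE, place, lie_f, lie_g, lie_h, lie_k, lie_l]
theorem lie_K0_F0 : ⁅e 3 0, e 0 0⁆ = 0 := by
  ext1 <;> simp [vec, place, lie_f, lie_g, lie_h, lie_k, lie_l]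
theorem lie_F0_F2 : ⁅e 0 0, e 0 2⁆ = (2 : ℝ) • e 0 1 := by
  ext1 <;> simp [vec, place, lie_f, lie_g, lie_h, lie_k, lie_l, smul_eq_C_mul]
  rw [show (2 : ℝ) = 1 + 1 by norm_num, C_add, C_1]
theorem lie_F0_H1 : ⁅e 0 0, e 2 1⁆ = e 2 0 := by
  ext1 <;> simp [vec, place, lie_f, lie_g, lie_h, lie_k, lie_l]
theorem lie_F0_L0 : ⁅e 0 0, e 4 0⁆ = 0 := by
  ext1 <;> simp [vec, place, lie_f, lie_g, lie_h, lie_k, lie_l]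
theorem lie_H1_L0 : ⁅e 2 1, e 4 0⁆ = 0 := by
  ext1 <;> simp [vec, place, lie_f, lie_g, lie_h, lie_k, lie_l]
theorem lie_F0_G1 : ⁅e 0 0, e 1 1⁆ = e 1 0 := by
  ext1 <;> simp [vec, place, lie_f, lie_g, lie_h, lie_k, lie_l]
theorem lie_G1_H1 : ⁅e 1 1, e 2 1⁆ = (-1 / 2 : ℝ) • e 3 0 := by
  ext1 <;> simp [vec, place, lie_f, lie_g, lie_h, lie_k, lie_l, smul_eq_C_mul, neg_div]
theorem lie_F0_G0 : ⁅e 0 0, e 1 0⁆ = 0 := by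
  ext1 <;> simp [vec, place, lie_f, lie_g, lie_h, lie_k, lie_l]
theorem lie_F0_H2 : ⁅e 0 0, e 2 2⁆ = (2 : ℝ) • e 2 1 := by
  ext1 <;> simp [vec, place, lie_f, lie_g, lie_h, lie_k, lie_l, smul_eq_C_mul]
  rw [show (2 : ℝ) = 1 + 1 by norm_num, C_add, C_1]
theorem lie_G0_H2 : ⁅e 1 0, e 2 2⁆ = (-2 : ℝ) • e 3 0 := by
  ext1 <;> simp [vec, place, lie_f, lie_g, lie_h, lie_k, lie_l, smul_eq_C_mul]
  rw [show (2 : ℝ) = 1 + 1 by norm_num, C_add, C_1]; ring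

end Brackets

/-! ### Cocycles -/

/-- The `F 1` terms of `3 η₁` and `η₂` cancel. Deforming by `λζ` is therefore deforming by `s α`
with `s = 12 λ`. -/
theorem ζ_eq : ζ = (12 : ℝ) • α := by
  rw [ζ, η₁, η₂]
  module

theorem smul_α_mem_H1 (s : ℝ) : s • α ∈ H1 G1 :=
  mem_H1_iff.2 fun X Y => by rw [LinearMap.smul_apply, α_lie, smul_zero]

/-- A closed 1-form kills all brackets. Each monomial vector of nonzero weight is a multiple of its
bracket with `vD`, and `vD` is half of the bracket of `f = 1` with `f = t²`; only the value on `vE`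
stays free. Conversely `α` kills brackets because their `a` component is zero. -/
theorem H1_eq : H1 G1 = Submodule.span ℝ {ζ} := by
  refine le_antisymm (fun θ hθ => ?_) ?_
  · rw [mem_H1_iff] at hθ
    -- Both sides must agree on `vE`, where `ζ` takes the value 12.
    refine Submodule.mem_span_singleton.2 ⟨θ vE / 12, ?_⟩
    rw [ζ_eq, smul_smul]
    refine LinearMap.ext_on span_vec ?_
    rintro _ ⟨p, rfl⟩
    by_cases hp : weight p = 0
    · rcases weight_eq_zero hp with rfl | rfl
      · change θ vE / 12 * 12 * α vE = θ vE
        rw [α_vE]; ring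
      -- `vD` has weight zero, so it is reached as a bracket through `[1, t²] = 2t` instead.
      · have h := hθ (vec (some (0, 0))) (vec (some (0, 2)))
        rw [lie_F0_F2, map_smul, smul_eq_mul] at h
        rw [LinearMap.smul_apply, α_vec_some]
        simp; linarith
    · rcases p with _ | ⟨i, n⟩
      · exact absurd rfl hp
      · have h := hθ vD (vec (some (i, n)))
        rw [lie_vD_vec, map_smul, smul_eq_mul] at h
        have hw : (weight (some (i, n)) : ℝ) / 3 ≠ 0 := by simpa using hp
        rw [LinearMap.smul_apply, α_vec_some, smul_zero]
        exact ((mul_eq_zero.1 h).resolve_left hw).symm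
  · rw [Submodule.span_le, Set.singleton_subset_iff, ζ_eq]
    exact smul_α_mem_H1 12

theorem ζ_ne_zero : ζ ≠ 0 := fun h => by
  have := congrArg (fun θ : Module.Dual ℝ G1 => θ vE) h
  simp [ζ_eq, α_vE] at this

/-- Up to a coboundary a cocycle is invariant under the Euler vector. -/
theorem exists_reduction (s : ℝ) (Θ : TwoForm G1) :
    ∃ β : Module.Dual ℝ G1, ∃ c : ℝ, (∀ Y, (Θ - dDef₁ (s • α) β) vD Y = c * α Y) ∧
      (Θ - dDef₁ (s • α) β) (vec (some (0, 0))) (vec (some (0, 2))) = 0 := by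
  -- Since `α vD = 0`, on `vec p` with `p ≠ none` the coboundary of `β` contracted with `vD` is
  -- `-(weight p / 3) β (vec p)`; solving for `β` gives the second branch. The value on `vD` is free
  -- for this purpose and is chosen to cancel `Θ` on the pair `1, t²` in the place `f`, whose
  -- bracket is `2 vD`. At `p = none` the division by zero gives the value 0, which is harmless:
  -- `vD` commutes with `vE`, so `β vE` enters neither condition.
  obtain ⟨β, hβ⟩ := exists_dual fun p => if p = some (0, 1) then
    -Θ (vec (some (0, 0))) (vec (some (0, 2))) / 2 else -(3 * Θ vD (vec p) / weight p)
  have hb : β vD = -Θ (vec (some (0, 0))) (vec (some (0, 2))) / 2 := by rw [hβ, if_pos rfl]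
  -- The constant is the value of the reduced form on `vD, vE`: the term `s α(vE) β(vD)` of the
  -- deformed differential survives there.
  refine ⟨β, Θ vD vE + s * β vD, fun Y => ?_, ?_⟩
  · suffices h : (Θ - dDef₁ (s • α) β).contract vD = (Θ vD vE + s * β vD) • α from
      congrArg (fun φ : Module.Dual ℝ G1 => φ Y) h
    refine LinearMap.ext_on span_vec ?_
    rintro _ ⟨p, rfl⟩
    rw [TwoForm.contract_apply, TwoForm.sub_apply, dDef₁_apply, lie_vD_vec]
    simp only [LinearMap.smul_apply, smul_eq_mul, map_smul, α_vec_some 0 1]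
    by_cases hp : weight p = 0
    · rcases weight_eq_zero hp with rfl | rfl
      · change Θ vD vE - (-(_ * β vE) + (s * 0 * β vE - s * α vE * β vD)) = _ * α vE
        rw [hp, α_vE]; simp
      · rw [hp, α_vec_some, TwoForm.self]; simp
    · rcases p with _ | ⟨i, n⟩
      · exact absurd rfl hp
      · have h1 : (some (i, n) : Option (Fin 5 × ℕ)) ≠ some (0, 1) := by
          intro h; rw [h] at hp; exact hp rfl
        have hw : (weight (some (i, n)) : ℝ) ≠ 0 := by exact_mod_cast hp
        rw [α_vec_some, hβ (some (i, n)), if_neg h1]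
        field_simp
        ring
  · rw [TwoForm.sub_apply, dDef₁_apply, lie_F0_F2]
    simp only [LinearMap.smul_apply, smul_eq_mul, map_smul, α_vec_some, hb]
    ring

/-- A cocycle whose contraction with the Euler vector is a multiple of `α` pairs only vectors of
opposite weights. -/
theorem apply_vec_eq_zero {s c : ℝ} {Θ : TwoForm G1} (hΘ : Θ ∈ Z2 (s • α))
    (hD : ∀ Y, Θ vD Y = c * α Y) {p q : Option (Fin 5 × ℕ)} (hpq : weight p + weight q ≠ 0) :
    Θ (vec p) (vec q) = 0 := by
  -- In this instance `Θ([p, q], vD)` vanishes because `α` kills brackets, and the two terms with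
  -- `Θ(vD, ·) = c α` cancel by symmetry. What is left is `-(weight p + weight q) / 3` times `Θ(vec
  -- p, vec q)`.
  have h := mem_Z2_iff.1 hΘ vD (vec p) (vec q)
  rw [Θ.swap _ vD, hD, hD, hD, α_lie, lie_vD_vec, lie_vD_vec, TwoForm.map_smul_left,
    TwoForm.map_smul_left, Θ.swap (vec q)] at h
  simp only [LinearMap.smul_apply, α_vec_some 0 1, smul_eq_mul] at h
  have h' : ((weight p + weight q : ℤ) : ℝ) * Θ (vec p) (vec q) = 0 := by
    push_cast
    linear_combination -3 * h
  exact (mul_eq_zero.1 h').resolve_left (by exact_mod_cast hpq)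

/-- The source of the exceptional value: `vE` acts on `k = 1` with eigenvalue `-3` and commutes with
`f = 1`, while `k = 1` and `f = 1` commute. The cocycle identity on the three vectors reduces to `(s
+ 3) Θ(K0, F0) = 0`. -/
theorem apply_K0_F0_eq_zero {s : ℝ} (hs : s ≠ -3) {Θ : TwoForm G1} (hΘ : Θ ∈ Z2 (s • α)) :
    Θ (vec (some (3, 0))) (vec (some (0, 0))) = 0 := by
  have h := mem_Z2_iff.1 hΘ vE (vec (some (3, 0))) (vec (some (0, 0)))
  rw [lie_vE_K0, lie_vE_F, lie_K0_F0, TwoForm.map_smul_left, TwoForm.map_zero_left,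
    TwoForm.map_zero_left] at h
  simp only [LinearMap.smul_apply, α_vec_some, α_vE, smul_eq_mul] at h
  have h' : (s + 3) * Θ (vec (some (3, 0))) (vec (some (0, 0))) = 0 := by linear_combination h
  exact (mul_eq_zero.1 h').resolve_left fun h0 => hs (by linarith)

/-- The two vectors commute and `α` vanishes on both, so neither term of the deformed differential
contributes. -/
theorem coboundary_K0_F0 {s : ℝ} {Θ : TwoForm G1} (hΘ : Θ ∈ B2 (s • α)) :
    Θ (vec (some (3, 0))) (vec (some (0, 0))) = 0 := by
  obtain ⟨θ, rfl⟩ := hΘ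
  rw [dDef₁_apply, lie_K0_F0]
  simp [α_vec_some]

/-- Up to order, the pairs of monomial vectors of opposite weights are `(vE, vD)`, `(F0, F2)`, `(F0,
K0)`, `(G0, H1)`, `(H0, G1)`, `(H0, L0)`, apart from a vector paired with itself. Two of these
values vanish by hypothesis; the cocycle identity disposes of the other four. -/
theorem eq_zero_of_cocycle {s c : ℝ} {Θ : TwoForm G1} (hΘ : Θ ∈ Z2 (s • α))
    (hD : ∀ Y, Θ vD Y = c * α Y) (hF : Θ (vec (some (0, 0))) (vec (some (0, 2))) = 0)
    (hK : Θ (vec (some (3, 0))) (vec (some (0, 0))) = 0) : Θ = 0 := by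
  have hz := mem_Z2_iff.1 hΘ
  -- Each triple has total weight zero. With the hypotheses `hF` and `hK`, `z1` gives `Θ(H0, L0) =
  -- 0`, `z3` gives `Θ(H1, G0) = 0`, `z2` relates `Θ(G0, H1)` to `Θ(H0, G1)`, and `z4` gives `Θ(vD,
  -- vE) = 0`.
  have z1 := hz (vec (some (0, 0))) (vec (some (2, 1))) (vec (some (4, 0)))
  have z2 := hz (vec (some (0, 0))) (vec (some (1, 1))) (vec (some (2, 1)))
  have z3 := hz (vec (some (0, 0))) (vec (some (1, 0))) (vec (some (2, 2)))
  have z4 := hz vE (vec (some (0, 0))) (vec (some (0, 2)))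
  rw [lie_F0_H1, lie_F0_L0, lie_H1_L0] at z1
  rw [lie_F0_G1, lie_F0_H1, lie_G1_H1] at z2
  rw [lie_F0_G0, lie_F0_H2, lie_G0_H2] at z3
  rw [lie_vE_F, lie_vE_F, lie_F0_F2] at z4
  simp only [TwoForm.map_smul_left, TwoForm.map_zero_left, LinearMap.smul_apply, α_vec_some,
    smul_zero, zero_mul, hK, hF, mul_zero, add_zero, sub_zero, neg_zero, zero_add,
    zero_sub] at z1 z2 z3 z4
  have hK' := Θ.swap (vec (some (0, 0))) (vec (some (3, 0)))
  have hE : Θ vD vE = 0 := by linarith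
  have z3' := Θ.swap (vec (some (2, 1))) (vec (some (1, 0)))
  -- values on the pairs of opposite weights, the vector of smaller weight first
  have key : ∀ p q, weight p ≤ 0 → weight p + weight q = 0 → Θ (vec p) (vec q) = 0 := by
    rintro (_ | ⟨i, m⟩) q hp hpq
    · rcases weight_eq_zero (p := q) (by simpa [weight] using hpq) with rfl | rfl
      · exact Θ.self _
      · rw [Θ.swap]
        change -Θ vD vE = 0
        rw [hE, neg_zero]
    · by_cases h0 : weight q = 0
      · have hp0 : weight (some (i, m)) = 0 := by omega
        rcases weight_eq_zero hp0 with h | h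
        · cases h
        · rw [h]
          rcases weight_eq_zero h0 with rfl | rfl
          · exact hE
          · exact Θ.self _
      · rcases q with _ | ⟨j, n⟩
        · exact absurd rfl h0
        -- Here the weight of the first vector is strictly negative, which leaves the constants in
        -- the places `f`, `g`, `h`, of weights `-3`, `-2`, `-1`.
        · have hp' : m = 0 ∧ (i = 0 ∨ i = 1 ∨ i = 2) := by
            have : weight (some (i, m)) < 0 := by omega
            fin_cases i <;> simp [weight] at this ⊢ <;> omega
          obtain ⟨rfl, rfl | rfl | rfl⟩ := hp'
          · have hq : j = 0 ∧ n = 2 ∨ j = 3 ∧ n = 0 := by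
              fin_cases j <;> simp [weight] at hpq ⊢ <;> omega
            obtain ⟨rfl, rfl⟩ | ⟨rfl, rfl⟩ := hq <;> linarith
          · have hq : j = 2 ∧ n = 1 := by
              fin_cases j <;> simp [weight] at hpq ⊢ <;> omega
            obtain ⟨rfl, rfl⟩ := hq
            linarith
          · have hq : j = 1 ∧ n = 1 ∨ j = 4 ∧ n = 0 := by
              fin_cases j <;> simp [weight] at hpq ⊢ <;> omega
            obtain ⟨rfl, rfl⟩ | ⟨rfl, rfl⟩ := hq <;> linarith
  refine TwoForm.ext_span span_vec ?_
  rintro _ ⟨p, rfl⟩ _ ⟨q, rfl⟩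
  rw [TwoForm.zero_apply]
  by_cases hpq : weight p + weight q = 0
  · rcases le_total (weight p) 0 with hp | hp
    · exact key p q hp hpq
    · rw [Θ.swap, key q p (by omega) (by omega), neg_zero]
  · exact apply_vec_eq_zero hΘ hD hpq

theorem mem_B2_of_apply_K0_F0 {s : ℝ} {Θ : TwoForm G1} (hΘ : Θ ∈ Z2 (s • α))
    (hK : Θ (vec (some (3, 0))) (vec (some (0, 0))) = 0) : Θ ∈ B2 (s • α) := by
  obtain ⟨β, c, hD, hF⟩ := exists_reduction s Θ
  have hβ := dDef₁_mem_B2 (s • α) β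
  have h := eq_zero_of_cocycle
    (Submodule.sub_mem _ hΘ (B2_le_Z2 (smul_α_mem_H1 s) hβ)) hD hF
    (by rw [TwoForm.sub_apply, hK, coboundary_K0_F0 hβ, sub_zero])
  rwa [sub_eq_zero.1 h]

/-! ### The cocycle `Ω` and the vanishing for other parameters -/

theorem smul_ζ (lam : ℝ) : lam • ζ = (12 * lam) • α := by
  rw [ζ_eq, smul_smul, mul_comm]

theorem Ω_mem_ideal : Ω ∈ ideal₂ (Set.range baseForms) := by
  -- The generators of `ideal₂` have a single base form as left factor, whereas the left factors in
  -- `Ω` are combinations of them; this extends membership by linearity.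
  have hw : ∀ {a b}, a ∈ Submodule.span ℝ (Set.range baseForms) →
      a ⋏ b ∈ ideal₂ (Set.range baseForms) := by
    intro a b ha
    induction ha using Submodule.span_induction with
    | mem a ha => exact Submodule.subset_span ⟨a, ha, b, rfl⟩
    | zero => simp
    | add a a' _ _ h h' =>
      rw [map_add, LinearMap.add_apply]; exact Submodule.add_mem _ h h'
    | smul c a _ h => rw [map_smul, LinearMap.smul_apply]; exact Submodule.smul_mem _ _ h
  have hb : ∀ i, baseForms i ∈ Submodule.span ℝ (Set.range baseForms) :=
    fun i => Submodule.subset_span ⟨i, rfl⟩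
  exact Submodule.add_mem _ (Submodule.add_mem _
    (Submodule.smul_mem _ _ (hw (Submodule.sub_mem _ (Submodule.sub_mem _ (hb 12) (hb 13))
      (Submodule.smul_mem _ _ (hb 14))))) (hw (hb 2))) (hw (hb 3))

/-- Conceptually, `Ω` is the weight-zero cocycle `θ₃ ⋏ ξ₁ + θ₂ ⋏ ξ₃ - η₃ ⋏ ξ₂` minus the deformed
differential of `ξ₁/3 + ξ₂ + ξ₃/2`. The check is direct: only finitely many derivatives at zero
enter, and the condition is a polynomial identity in them. -/
theorem Ω_mem_Z2 : Ω ∈ Z2 ((-3 : ℝ) • α) := by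
  refine mem_Z2_iff.2 fun X Y Z => ?_
  simp only [Ω, θ₂, θ₃, ξ₁, ξ₂, ξ₃, η₁, η₂, η₃, wedge_apply, TwoForm.add_apply,
    TwoForm.smul_apply, LinearMap.add_apply, LinearMap.sub_apply,
    LinearMap.neg_apply, LinearMap.smul_apply, smul_eq_mul, α_apply, F_apply, G_apply, H_apply,
    K_apply, lie_a, lie_f, lie_g, lie_h, lie_k, Function.iterate_succ,
    Function.iterate_zero, Function.comp_apply, id_eq, derivative_add, derivative_sub,
    derivative_mul, derivative_C, zero_mul, zero_add, eval_add, eval_sub, eval_mul, eval_C]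
  ring

theorem Ω_K0_F0 : Ω (vec (some (3, 0))) (vec (some (0, 0))) = 1 := by
  simp [Ω, θ₂, θ₃, ξ₁, ξ₂, ξ₃, η₁, η₂, η₃, wedge_apply, α_apply, F_apply, G_apply, H_apply,
    K_apply, vec, place]

theorem inIdeal_eq_bot {lam : ℝ} (hlam : lam ≠ -1 / 4) :
    H2.inIdeal (lam • ζ) (Set.range baseForms) = ⊥ := by
  rw [smul_ζ, eq_bot_iff]
  -- Membership in the ideal is dropped: every deformed 2-cocycle is exact for these parameters.
  rintro _ ⟨⟨Θ, hΘ⟩, -, rfl⟩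
  refine (Submodule.Quotient.mk_eq_zero _).2 (mem_B2_of_apply_K0_F0 hΘ ?_)
  exact apply_K0_F0_eq_zero (fun h => hlam (by linarith)) hΘ

end PKhZ

end

/-! ### Assembly of the theorem -/

theorem mainTheorem1 :
    PKhZ.StructureEquations ∧
    LieForms.IsNormalProlongation PKhZ.baseForms PKhZ.newForms ∧
    LieForms.H1 PKhZ.G1 = Submodule.span ℝ {PKhZ.ζ} ∧
    PKhZ.ζ ≠ 0 ∧
    (∀ lam : ℝ, lam ≠ -1 / 4 →
      LieForms.H2.inIdeal (lam • PKhZ.ζ) (Set.range PKhZ.baseForms) = ⊥) ∧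
    ∃ hΩ : PKhZ.Ω ∈ LieForms.Z2 ((-1 / 4 : ℝ) • PKhZ.ζ),
      PKhZ.Ω ∈ LieForms.ideal₂ (Set.range PKhZ.baseForms) ∧
      LieForms.H2.inIdeal ((-1 / 4 : ℝ) • PKhZ.ζ) (Set.range PKhZ.baseForms) =
        Submodule.span ℝ {LieForms.H2.cls ((-1 / 4 : ℝ) • PKhZ.ζ) ⟨PKhZ.Ω, hΩ⟩} ∧
      Module.finrank ℝ
        (LieForms.H2.inIdeal ((-1 / 4 : ℝ) • PKhZ.ζ) (Set.range PKhZ.baseForms)) = 1 := by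
  have hs : (-1 / 4 : ℝ) • PKhZ.ζ = (-3 : ℝ) • PKhZ.α := by
    rw [PKhZ.smul_ζ]; norm_num
  have hΩ : PKhZ.Ω ∈ LieForms.Z2 ((-1 / 4 : ℝ) • PKhZ.ζ) := hs ▸ PKhZ.Ω_mem_Z2
  have hspan : LieForms.H2.inIdeal ((-1 / 4 : ℝ) • PKhZ.ζ) (Set.range PKhZ.baseForms) =
      Submodule.span ℝ {LieForms.H2.cls ((-1 / 4 : ℝ) • PKhZ.ζ) ⟨PKhZ.Ω, hΩ⟩} := by
    refine le_antisymm ?_ ?_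
    · rintro _ ⟨⟨Θ, hΘ⟩, -, rfl⟩
      -- As `Ω(K0, F0) = 1`, the only possible coefficient of `[Ω]` is `Θ(K0, F0)`; the difference
      -- then vanishes on this pair and is a coboundary.
      refine Submodule.mem_span_singleton.2
        ⟨Θ (PKhZ.vec (some (3, 0))) (PKhZ.vec (some (0, 0))), ?_⟩
      rw [← map_smul, ← sub_eq_zero, ← map_sub]
      refine (Submodule.Quotient.mk_eq_zero _).2 ?_
      have h := Submodule.sub_mem _ (Submodule.smul_mem _
        (Θ (PKhZ.vec (some (3, 0))) (PKhZ.vec (some (0, 0)))) hΩ) hΘ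
      change _ • PKhZ.Ω - Θ ∈ LieForms.B2 _
      rw [hs] at h ⊢
      refine PKhZ.mem_B2_of_apply_K0_F0 h ?_
      rw [LieForms.TwoForm.sub_apply, LieForms.TwoForm.smul_apply, PKhZ.Ω_K0_F0]
      ring
    · rw [Submodule.span_le, Set.singleton_subset_iff]
      exact ⟨⟨PKhZ.Ω, hΩ⟩, PKhZ.Ω_mem_ideal, rfl⟩
  refine ⟨PKhZ.structureEquations, PKhZ.isNormalProlongation, PKhZ.H1_eq, PKhZ.ζ_ne_zero,
    fun _ => PKhZ.inIdeal_eq_bot, hΩ, PKhZ.Ω_mem_ideal, hspan, ?_⟩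
  rw [hspan]
  -- The class of `Ω` is nonzero, since coboundaries vanish on the pair where `Ω` equals 1.
  refine finrank_span_singleton fun h => ?_
  have h' : PKhZ.Ω ∈ LieForms.B2 ((-1 / 4 : ℝ) • PKhZ.ζ) :=
    (Submodule.Quotient.mk_eq_zero (p := (LieForms.B2 _).submoduleOf (LieForms.Z2 _))).1 h
  rw [hs] at h'
  exact one_ne_zero (PKhZ.Ω_K0_F0.symm.trans (PKhZ.coboundary_K0_F0 h'))
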